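/- **Setting.** A one-layer transformer with $h$ heads acts on token matrices $X\in\mathbb R^{D\times n}$ (one column per token, any $n$) by $$\mathrm{Attn}(X)=X+\sum_{i=1}^h W_V^{(i)}X\,\mathrm{softmax}\big(X^\top W_K^{(i)\top}W_Q^{(i)}X\big),\qquad \mathrm{TF}(X)=\mathrm{Attn}(X)+W_2\,\mathrm{ReLU}\big(W_1\mathrm{Attn}(X)+b_1\mathbf 1^\top\big)+b_2\mathbf 1^\top,$$ with column-wise softmax and a feed-forward network of arbitrary finite width; an $m$-layer $h$-head transformer is a composition of $m$ of these. An AlgoFormer consists of three transformers $\mathrm{TF}_{\rm pre},\mathrm{TF}_{\rm loop},\mathrm{TF}_{\rm post}$; with $t$ loops it outputs $\mathrm{TF}_{\rm post}(\mathrm{TF}_{\rm loop}^{\,t}(\mathrm{TF}_{\rm pre}(X)))$. Let $\sigma$ be the leaky ReLU with slope $\alpha>0$ on the negative half-line, applied coordinate-wise. Weight matrices $W^1,\dots,W^L\in\mathbb R^{d\times d}$ and an initial point $x\in\mathbb R^d$ generate the chain $s^0=x$, $s^{j}=\sigma(W^{j}s^{j-1})$, $1\le j\le L$. Let $s_i^j$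 be the chain of the sample $x_i$ ($1\le i\le N$, $N\ge1$) and $\hat s^j$ that of $x_{\rm test}$. For $0\le\ell<L$ the prompt $P_\ell$ has the tokens $$x_1,s_1^1,\dots,s_1^L,\ \dots,\ x_N,s_N^1,\dots,s_N^L,\ x_{\rm test},\hat s^1,\dots,\hat s^\ell .$$ The columns of $P_\ell$ have dimension $3d+3+k$: a current-state block, a next-state block and a residual block of $d$ coordinates each, three indicators, and $k$ further coordinates. In $P_\ell$ the state is in the current-state block, the last $k$ coordinates hold a positional embedding $p(n)\in\mathbb R^k$ that depends only on the position $n$ of the token in the prompt, and all other entries are $0$. For $A\in\mathbb R^{d\times d}$ let $y_i=\sigma^{-1}(s_i^{\ell+1})$ and $\mathcal L_\ell(A)=\frac1{2N}\sum_{i=1}^N\|As_i^\ell-y_i\|_2^2$. Given $A_0$ and a step size $\eta>0$, let $A_{t+1}=A_t-\eta\nabla\mathcal L_\ell(A_t)$. The *filtered prompt* $Q_\ell(A)$ has in its current-state block $s_i^\ell$ at the token of $s_i^\ell$ and $\hat s^\ell$ at the last token; in its next-state block $s_i^{\ell+1}$ at the token of $s_i^{\ell+1}$; in its residual block $As_i^\ell-y_i$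 at the token of $s_i^\ell$ and $A\hat s^\ell$ at the last token; its three indicators are the $0$-$1$ indicators of the tokens of $s_1^\ell,\dots,s_N^\ell,\hat s^\ell$, of the tokens of $s_1^{\ell+1},\dots,s_N^{\ell+1}$, and of the last token; all other entries are $0$. **Theorem.** Let $d,L\ge 0$, $N\ge1$ and $\alpha>0$. There are $k$ and a positional embedding $p:\mathbb N\to\mathbb R^k$ such that for all $B\in\mathbb R$ and $A_0\in\mathbb R^{d\times d}$ there are $\eta_0>0$ and $C\in\mathbb R$ with the following property. For all $\eta>0$, $T\in\mathbb N$ and $\varepsilon>0$ there is an AlgoFormer, with $\mathrm{TF}_{\rm pre}$ a seven-layer two-head, $\mathrm{TF}_{\rm loop}$ a one-layer two-head and $\mathrm{TF}_{\rm post}$ a one-layer one-head transformer, such that for all $W^1,\dots,W^L,x_1,\dots,x_N,x_{\rm test}$ with entries of absolute value at most $B$, all $0\le\ell<L$ and all $0\le t\le T$: 1. (filtering and gradient descent) $\mathrm{TF}_{\rm loop}^{\,t}(\mathrm{TF}_{\rm pre}(P_\ell))$ differs from $Q_\ell(A_t)$ by at most $\varepsilon$ in every entry of the first $3d+3$ rows;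 2. the next-state block of the last token of $\mathrm{TF}_{\rm post}(\mathrm{TF}_{\rm loop}^{\,t}(\mathrm{TF}_{\rm pre}(P_\ell)))$ differs from $\sigma(A_t\hat s^\ell)$ by at most $\varepsilon$ in every coordinate; 3. (finding $\hat s^{\ell+1}$) if $\eta\le\eta_0$, $\hat s^\ell\in V:=\mathrm{span}\{s_1^\ell,\dots,s_N^\ell\}$, and $\kappa>0$ satisfies $\kappa\|v\|_2^2\le\frac1N\sum_i\langle s_i^\ell,v\rangle^2$ for all $v\in V$, then this block differs from the true next state $\hat s^{\ell+1}$ by at most $\varepsilon+Ce^{-\eta\kappa t}$ in every coordinate. In particular, the AlgoFormer depends neither on the weights and the data nor on $\ell$. -/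

import Mathlib

noncomputable section

namespace CoTMLP

/-! ### Transformers and the AlgoFormer

Token matrices have rows indexed by `ι` (the embedding coordinates) and one column per token. The
column type `τ` may vary: the parameters of a transformer do not depend on the number of tokens. -/

/-- The column-wise softmax of a matrix. -/
def softmax {τ : Type} [Fintype τ] (Z : Matrix τ τ ℝ) : Matrix τ τ ℝ :=
  Matrix.of fun i j => Real.exp (Z i j) / ∑ i', Real.exp (Z i' j)

/-- The ReLU activation. -/
def relu (z : ℝ) : ℝ := max z 0

/-- The parameters of a one-layer transformer with `h` heads. -/
structure Layer (ι : Type) (h : ℕ) where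
  /-- value matrices -/
  WV : Fin h → Matrix ι ι ℝ
  /-- key matrices -/
  WK : Fin h → Matrix ι ι ℝ
  /-- query matrices -/
  WQ : Fin h → Matrix ι ι ℝ
  /-- width of the shallow feed-forward network -/
  width : ℕ
  W₁ : Matrix (Fin width) ι ℝ
  b₁ : Fin width → ℝ
  W₂ : Matrix ι (Fin width) ℝ
  b₂ : ι → ℝ

namespace Layer

variable {ι : Type} [Fintype ι] {h : ℕ} {τ : Type} [Fintype τ]

/-- Full softmax attention with a residual connection. -/
def attn (l : Layer ι h) (X : Matrix ι τ ℝ) : Matrix ι τ ℝ :=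
  X + ∑ i, l.WV i * X * softmax (X.transpose * (l.WK i).transpose * l.WQ i * X)

/-- A one-layer transformer: attention, then the token-wise feed-forward ReLU network, again with a
residual connection. -/
def eval (l : Layer ι h) (X : Matrix ι τ ℝ) : Matrix ι τ ℝ :=
  l.attn X
    + l.W₂ * (l.W₁ * l.attn X + Matrix.of fun i _ => l.b₁ i).map relu
    + Matrix.of fun i _ => l.b₂ i

end Layer

/-- An `m`-layer, `h`-head transformer. -/
abbrev Transformer (ι : Type) (m h : ℕ) : Type := Fin m → Layer ι h

/-- The layers are applied one after the other, layer `0` first. -/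
def Transformer.eval {ι : Type} [Fintype ι] {h : ℕ} {τ : Type} [Fintype τ] :
    {m : ℕ} → Transformer ι m h → Matrix ι τ ℝ → Matrix ι τ ℝ
  | 0, _, X => X
  | _ + 1, f, X => Transformer.eval (fun i => f i.succ) ((f 0).eval X)

/-- An AlgoFormer whose pre-, looped and post-transformers have the given numbers of layers and
heads. -/
structure AlgoFormer (ι : Type) (mPre hPre mLoop hLoop mPost hPost : ℕ) where
  pre : Transformer ι mPre hPre
  loop : Transformer ι mLoop hLoop
  post : Transformer ι mPost hPost

namespace AlgoFormer

variable {ι : Type} [Fintype ι] {mPre hPre mLoop hLoop mPost hPost : ℕ} {τ : Type} [Fintype τ]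

/-- The token matrix after the pre-transformer and `t` iterations of the looped transformer. -/
def hidden (F : AlgoFormer ι mPre hPre mLoop hLoop mPost hPost) (t : ℕ) (X : Matrix ι τ ℝ) :
    Matrix ι τ ℝ :=
  (fun Y => F.loop.eval Y)^[t] (F.pre.eval X)

/-- The output of the AlgoFormer run with `t` iterations of the looped transformer. -/
def output (F : AlgoFormer ι mPre hPre mLoop hLoop mPost hPost) (t : ℕ) (X : Matrix ι τ ℝ) :
    Matrix ι τ ℝ :=
  F.post.eval (F.hidden t X)

end AlgoFormer

/-! ### Chain-of-thought sequences generated by leaky-ReLU MLPs -/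

/-- Leaky ReLU with slope `α` on the negative half-line. -/
def leaky (α z : ℝ) : ℝ := if 0 ≤ z then z else α * z

/-- The inverse of leaky ReLU. -/
def leakyInv (α z : ℝ) : ℝ := if 0 ≤ z then z else z / α

theorem leakyInv_leaky {α : ℝ} (hα : 0 < α) (z : ℝ) : leakyInv α (leaky α z) = z := by
  unfold leakyInv leaky
  by_cases hz : 0 ≤ z
  · simp [hz]
  · have h : ¬ 0 ≤ α * z := not_le.2 (mul_neg_of_pos_of_neg hα (not_le.1 hz))
    simp [hz, h, mul_div_cancel_left₀ z hα.ne']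

variable {d L N : ℕ}

/-- The chain `x = s⁰, s¹, …, sᴸ` of layer outputs of the `L`-layer leaky-ReLU MLP: `s^(j+1)` is leaky
ReLU applied coordinate-wise to `W j *ᵥ s^j`. -/
def chain (α : ℝ) (W : Fin L → Matrix (Fin d) (Fin d) ℝ) (x : Fin d → ℝ) :
    Fin (L + 1) → Fin d → ℝ :=
  Fin.induction (motive := fun _ => Fin d → ℝ) x fun j s a => leaky α ((W j).mulVec s a)

/-- The tokens of the prompt
`x₁, s₁¹, …, s₁ᴸ, …, x_N, s_N¹, …, s_Nᴸ, x_test, ŝ¹, …, ŝ^ℓ`: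
`Sum.inl (i, j)` is the token of `s_i^j`, and `Sum.inr j` the token of `ŝ^j` (state `0` is the
initial point). -/
abbrev Tok (N : ℕ) {L : ℕ} (l : Fin L) : Type := (Fin N × Fin (L + 1)) ⊕ Fin ((l : ℕ) + 1)

/-- The last token, that of `ŝ^ℓ`. -/
abbrev lastTok (N : ℕ) {L : ℕ} (l : Fin L) : Tok N l := Sum.inr (Fin.last (l : ℕ))

/-- The place of a token in the prompt, counted from `0`. -/
def pos {l : Fin L} : Tok N l → ℕ
  | Sum.inl (i, j) => (i : ℕ) * (L + 1) + (j : ℕ)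
  | Sum.inr j => N * (L + 1) + (j : ℕ)

/-- The chain-of-thought state carried by a token. -/
def tokState (α : ℝ) (W : Fin L → Matrix (Fin d) (Fin d) ℝ) (xs : Fin N → Fin d → ℝ)
    (xtest : Fin d → ℝ) {l : Fin L} : Tok N l → Fin d → ℝ
  | Sum.inl (i, j) => chain α W (xs i) j
  | Sum.inr j => chain α W xtest (Fin.castLE (Nat.succ_le_succ l.isLt.le) j)

/-- The coordinates of an embedded token with a designated meaning: three blocks of `d` coordinates
(current state, next state, residual) and three indicators. -/
abbrev CoreRow (d : ℕ) : Type := (Fin d ⊕ Fin d ⊕ Fin d) ⊕ Fin 3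

/-- All coordinates of an embedded token; the last `k` are for the positional embedding and for
intermediate results. -/
abbrev Row (d k : ℕ) : Type := CoreRow d ⊕ Fin k

/-- The coordinates of the current-state block. -/
abbrev CoreRow.cur (a : Fin d) : CoreRow d := Sum.inl (Sum.inl a)
/-- The coordinates of the next-state block. -/
abbrev CoreRow.next (a : Fin d) : CoreRow d := Sum.inl (Sum.inr (Sum.inl a))

/-- The input of the AlgoFormer: states (zero-padded) together with a positional embedding `p`, which
depends on nothing but the place of the token. -/
def prompt {k : ℕ} (p : ℕ → Fin k → ℝ) (α : ℝ) (W : Fin L → Matrix (Fin d) (Fin d) ℝ)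
    (xs : Fin N → Fin d → ℝ) (xtest : Fin d → ℝ) (l : Fin L) : Matrix (Row d k) (Tok N l) ℝ :=
  Matrix.of fun r c =>
    match r with
    | Sum.inl (Sum.inl (Sum.inl a)) => tokState α W xs xtest c a
    | Sum.inl _ => 0
    | Sum.inr b => p (pos c) b

/-! ### Gradient descent for multivariate regression -/

/-- The loss `(1 / 2N) ∑ᵢ ‖A uᵢ - yᵢ‖²`. -/
def loss (u y : Fin N → Fin d → ℝ) (A : Matrix (Fin d) (Fin d) ℝ) : ℝ :=
  1 / (2 * (N : ℝ)) * ∑ i, ∑ a, (A.mulVec (u i) a - y i a) ^ 2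

/-- The gradient `(1 / N) ∑ᵢ (A uᵢ - yᵢ) uᵢᵀ` of the loss. -/
def lossGrad (u y : Fin N → Fin d → ℝ) (A : Matrix (Fin d) (Fin d) ℝ) :
    Matrix (Fin d) (Fin d) ℝ :=
  Matrix.of fun a b => 1 / (N : ℝ) * ∑ i, (A.mulVec (u i) a - y i a) * u i b

/-- `lossGrad` is the gradient of `loss`: it represents all directional derivatives. -/
theorem hasDerivAt_loss (u y : Fin N → Fin d → ℝ) (A E : Matrix (Fin d) (Fin d) ℝ) :
    HasDerivAt (fun t : ℝ => loss u y (A + t • E)) (∑ a, ∑ b, lossGrad u y A a b * E a b) 0 := by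
  have key : ∀ i a, HasDerivAt
      (fun t : ℝ => ((A + t • E).mulVec (u i) a - y i a) ^ 2)
      (2 * (A.mulVec (u i) a - y i a) * E.mulVec (u i) a) 0 := by
    intro i a
    have h1 : HasDerivAt (fun t : ℝ => (A + t • E).mulVec (u i) a - y i a)
        (E.mulVec (u i) a) 0 := by
      have : (fun t : ℝ => (A + t • E).mulVec (u i) a - y i a)
          = fun t : ℝ => A.mulVec (u i) a + t * E.mulVec (u i) a - y i a := by
        funext t
        simp [Matrix.add_mulVec, Matrix.smul_mulVec]
      rw [this]
      simpa using (((hasDerivAt_id (0 : ℝ)).mul_const (E.mulVec (u i) a)).const_add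
        (A.mulVec (u i) a)).sub_const (y i a)
    simpa using h1.fun_pow 2
  have h2 := (HasDerivAt.fun_sum (u := Finset.univ) fun i _ =>
    HasDerivAt.fun_sum (u := Finset.univ) fun a _ => key i a).const_mul (1 / (2 * (N : ℝ)))
  refine h2.congr_deriv ?_
  simp only [lossGrad, Matrix.of_apply, Matrix.mulVec, dotProduct, Finset.mul_sum, Finset.sum_mul]
  rw [Finset.sum_comm]
  refine Finset.sum_congr rfl fun a _ => ?_
  rw [Finset.sum_comm]
  refine Finset.sum_congr rfl fun b _ => Finset.sum_congr rfl fun i _ => ?_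
  by_cases hN : (N : ℝ) = 0
  · simp [hN]
  · field_simp

/-- The `t`-th iterate of gradient descent on `loss u y` with step size `η` and initial guess `A₀`. -/
def gradDescent (u y : Fin N → Fin d → ℝ) (η : ℝ) (A₀ : Matrix (Fin d) (Fin d) ℝ) :
    ℕ → Matrix (Fin d) (Fin d) ℝ
  | 0 => A₀
  | t + 1 => gradDescent u y η A₀ t - η • lossGrad u y (gradDescent u y η A₀ t)

/-! ### The regression problem hidden in the prompt, and the filtered prompt -/

/-- The regressors `s_i^ℓ`. -/
def regIn (α : ℝ) (W : Fin L → Matrix (Fin d) (Fin d) ℝ) (xs : Fin N → Fin d → ℝ) (l : Fin L) :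
    Fin N → Fin d → ℝ :=
  fun i => chain α W (xs i) l.castSucc

/-- The regression targets: leaky ReLU is undone on the states `s_i^(ℓ+1)`. -/
def regOut (α : ℝ) (W : Fin L → Matrix (Fin d) (Fin d) ℝ) (xs : Fin N → Fin d → ℝ) (l : Fin L) :
    Fin N → Fin d → ℝ :=
  fun i a => leakyInv α (chain α W (xs i) l.succ a)

/-- The filtered prompt, for a current estimate `A` of the weight matrix. Only the states `s_i^ℓ`,
`s_i^(ℓ+1)` and `ŝ^ℓ` are kept; all other tokens vanish. The residual block holds
`A s_i^ℓ - y_i` at the tokens of `s_i^ℓ` and `A ŝ^ℓ` at the last token; the three indicators mark the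
tokens of `s_i^ℓ` and `ŝ^ℓ`, the tokens of `s_i^(ℓ+1)`, and the last token. -/
def filtered (α : ℝ) (W : Fin L → Matrix (Fin d) (Fin d) ℝ) (xs : Fin N → Fin d → ℝ)
    (xtest : Fin d → ℝ) (l : Fin L) (A : Matrix (Fin d) (Fin d) ℝ) :
    Matrix (CoreRow d) (Tok N l) ℝ :=
  Matrix.of fun r c =>
    match r, c with
    | Sum.inl (Sum.inl a), Sum.inl (i, j) =>
        if j = l.castSucc then chain α W (xs i) l.castSucc a else 0
    | Sum.inl (Sum.inl a), Sum.inr j =>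
        if j = Fin.last (l : ℕ) then chain α W xtest l.castSucc a else 0
    | Sum.inl (Sum.inr (Sum.inl a)), Sum.inl (i, j) =>
        if j = l.succ then chain α W (xs i) l.succ a else 0
    | Sum.inl (Sum.inr (Sum.inl _)), Sum.inr _ => 0
    | Sum.inl (Sum.inr (Sum.inr a)), Sum.inl (i, j) =>
        if j = l.castSucc then
          A.mulVec (regIn α W xs l i) a - regOut α W xs l i a
        else 0
    | Sum.inl (Sum.inr (Sum.inr a)), Sum.inr j =>
        if j = Fin.last (l : ℕ) then A.mulVec (chain α W xtest l.castSucc) a else 0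
    | Sum.inr 0, Sum.inl (_, j) => if j = l.castSucc then 1 else 0
    | Sum.inr 0, Sum.inr j => if j = Fin.last (l : ℕ) then 1 else 0
    | Sum.inr 1, Sum.inl (_, j) => if j = l.succ then 1 else 0
    | Sum.inr 1, Sum.inr _ => 0
    | Sum.inr 2, Sum.inl _ => 0
    | Sum.inr 2, Sum.inr j => if j = Fin.last (l : ℕ) then 1 else 0

end CoTMLP

end

open CoTMLP

noncomputable section

namespace CoTMLP

/-! ### Universal approximation by shallow ReLU networks -/

/-! Attention is needed only once. With zero key and query matrices all scores vanish, softmax is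
uniform, and a head adds a linear image of the mean token to every token (`exists_layer`). The
feed-forward network then applies any continuous map up to small error on a ball
(`exists_isNet_near`).

The positional embedding is one-hot over the places of the longest prompt. The first layer
multiplies this code by the state, so each token holds its state at its own place; averaging then
writes the whole prompt, divided by its length n, into every token. The mean of the code shows which
places are occupied, hence n and `ℓ`, so the filtered token is a continuous function of what the
token now holds (`collect_gather`). Each token thereby owns all regressors, all targets and an
estimate of the matrix, so a step of gradient descent is a continuous tokenwise map
(`gradStep_enc`). The loop and the post-transformer need no attention, and five of the seven first
layers are identities. As `T` and the bound on the data are fixed in advance, all exact intermediate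
tokens lie in fixed balls, and uniform continuity there controls the error of up to `T` iterations
(`iterate_near`).

For the last claim, undoing the leaky ReLU makes the regression exactly linear, y = W u. With second
moment matrix Σ this gives (A_t - W) v = (A_0 - W)(I - ηΣ)^t v. For small η the symmetric map I - ηΣ
is positive semidefinite, and on the span of the samples it contracts by exp(-ηκ)
(`contraction_dotProduct_contraction_le`). -/

theorem continuous_relu : Continuous relu := by
  unfold relu; fun_prop

/-- The piecewise linear ramp from `0` at `s` to `1` at `s + δ`. -/
def ramp (s δ z : ℝ) : ℝ := δ⁻¹ * relu (z - s) - δ⁻¹ * relu (z - (s + δ))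

theorem ramp_of_le {s δ z : ℝ} (hδ : 0 < δ) (h : z ≤ s) : ramp s δ z = 0 := by
  simp [ramp, relu, max_eq_right (sub_nonpos.2 h), max_eq_right (show z - (s + δ) ≤ 0 by linarith)]

theorem ramp_of_ge {s δ z : ℝ} (hδ : 0 < δ) (h : s + δ ≤ z) : ramp s δ z = 1 := by
  rw [ramp, relu, relu, max_eq_left (by linarith), max_eq_left (by linarith), ← mul_sub]
  rw [show z - s - (z - (s + δ)) = δ by ring, inv_mul_cancel₀ hδ.ne']

theorem ramp_mem_Icc {s δ z : ℝ} (hδ : 0 < δ) (h₁ : s ≤ z) (h₂ : z ≤ s + δ) :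
    ramp s δ z ∈ Set.Icc (0 : ℝ) 1 := by
  rw [ramp, relu, relu, max_eq_left (by linarith), max_eq_right (by linarith), mul_zero, sub_zero]
  refine ⟨mul_nonneg (inv_nonneg.2 hδ.le) (by linarith), ?_⟩
  rw [inv_mul_le_iff₀ hδ]; linarith

/-- The univariate shallow ReLU networks. -/
def reluSpan : Submodule ℝ (ℝ → ℝ) :=
  Submodule.span ℝ (Set.range fun (q : ℝ × ℝ) (z : ℝ) => relu (q.1 * z + q.2))

theorem relu_mem_reluSpan (w b : ℝ) : (fun z => relu (w * z + b)) ∈ reluSpan :=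
  Submodule.subset_span ⟨(w, b), rfl⟩

theorem const_mem_reluSpan (c : ℝ) : (fun _ => c) ∈ reluSpan := by
  convert reluSpan.smul_mem c (relu_mem_reluSpan 0 1) using 1
  funext z; simp [relu]

theorem ramp_mem_reluSpan (s δ : ℝ) : ramp s δ ∈ reluSpan := by
  convert reluSpan.sub_mem (reluSpan.smul_mem δ⁻¹ (relu_mem_reluSpan 1 (-s)))
    (reluSpan.smul_mem δ⁻¹ (relu_mem_reluSpan 1 (-(s + δ)))) using 1
  funext z; simp [ramp, sub_eq_add_neg]

/-- Piecewise linear interpolation on a grid of mesh δ, built from left to right with one ramp per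
cell. -/
theorem exists_reluSpan_near (g : ℝ → ℝ) (hg : Continuous g) (m : ℝ) {ε : ℝ} (hε : 0 < ε) :
    ∃ f ∈ reluSpan, ∀ z, |z| ≤ m → |f z - g z| ≤ ε := by
  -- The interval reaches to `m + 1` because the last grid point may exceed `m`, by at most δ ≤ 1.
  have huc := (isCompact_Icc (a := -m) (b := m + 1)).uniformContinuousOn_of_continuous
    hg.continuousOn
  obtain ⟨δ', hδ', hu⟩ := Metric.uniformContinuousOn_iff.1 huc (ε / 2) (half_pos hε)
  set δ := min (δ' / 2) 1 with hδdef
  have hδ : 0 < δ := lt_min (half_pos hδ') one_pos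
  have hδ1 : δ ≤ 1 := min_le_right _ _
  have hδ2 : δ < δ' := (min_le_left _ _).trans_lt (half_lt_self hδ')
  have close : ∀ y z, -m ≤ y → y ≤ m + 1 → -m ≤ z → z ≤ m + 1 → |y - z| ≤ δ →
      |g y - g z| ≤ ε / 2 := fun y z h1 h2 h3 h4 h =>
    (hu y ⟨h1, h2⟩ z ⟨h3, h4⟩ (by rw [Real.dist_eq]; exact h.trans_lt hδ2)).le
  -- To the right of the current grid point `f` is kept constant, so the next ramp starts from the
  -- exact value of `g` and leaves the earlier cells unchanged.
  have key : ∀ n : ℕ, ∃ f ∈ reluSpan, (∀ z, -m + n * δ ≤ z → f z = g (-m + n * δ)) ∧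
      ∀ z, |z| ≤ m → z ≤ -m + n * δ → |f z - g z| ≤ ε := by
    intro n
    induction n with
    | zero =>
      refine ⟨_, const_mem_reluSpan (g (-m)), by simp, fun z h1 h2 => ?_⟩
      have : z = -m := le_antisymm (by simpa using h2) (abs_le.1 h1).1
      simp [this, hε.le]
    | succ n ih =>
      obtain ⟨f, hf, hf1, hf2⟩ := ih
      have hs : -m + ((n + 1 : ℕ) : ℝ) * δ = -m + n * δ + δ := by push_cast; ring
      rw [hs]
      have hs0 : -m ≤ -m + (n : ℝ) * δ := le_add_of_nonneg_right (by positivity)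
      generalize -m + (n : ℝ) * δ = s at *
      refine ⟨fun z => f z + (g (s + δ) - g s) * ramp s δ z,
        reluSpan.add_mem hf (reluSpan.smul_mem _ (ramp_mem_reluSpan s δ)), fun z hz => ?_,
        fun z hz hzs => ?_⟩
      · simp only
        rw [hf1 z (by linarith), ramp_of_ge hδ hz]; ring
      · have hz' := abs_le.1 hz
        rcases le_total z s with h | h
        · simpa [ramp_of_le hδ h] using hf2 z hz h
        · simp only
          rw [hf1 z h]
          obtain ⟨r0, r1⟩ := ramp_mem_Icc hδ h hzs
          have c1 := close s z hs0 (by linarith) hz'.1 (by linarith)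
            (abs_le.2 ⟨by linarith, by linarith⟩)
          have c2 := close (s + δ) s (by linarith) (by linarith) hs0 (by linarith)
            (by rw [add_sub_cancel_left, abs_of_pos hδ])
          calc |g s + (g (s + δ) - g s) * ramp s δ z - g z|
              = |(g s - g z) + (g (s + δ) - g s) * ramp s δ z| := by ring_nf
            _ ≤ |g s - g z| + |g (s + δ) - g s| * |ramp s δ z| := by
                rw [← abs_mul]; exact abs_add_le _ _
            _ ≤ ε / 2 + ε / 2 * 1 := by
                rw [abs_of_nonneg r0]; gcongr
            _ = ε := by ring
  obtain ⟨n, hn⟩ := exists_nat_ge (2 * m / δ)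
  obtain ⟨f, hf, -, h⟩ := key n
  refine ⟨f, hf, fun z hz => h z hz ?_⟩
  rw [div_le_iff₀ hδ] at hn
  linarith [(abs_le.1 hz).2]

/-- The restriction of the ridge function `x ↦ g (w ⬝ᵥ x)` to a ball. -/
def ridge {ι : Type} [Fintype ι] (R : ℝ) (g : ℝ → ℝ) (hg : Continuous g) (w : ι → ℝ) (b : ℝ) :
    C(Metric.closedBall (0 : ι → ℝ) R, ℝ) :=
  ⟨fun x => g (w ⬝ᵥ x.1 + b), hg.comp
    ((continuous_const.dotProduct continuous_subtype_val).add continuous_const)⟩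

section Universal

variable {ι : Type} [Fintype ι]

/-- The shallow ReLU networks on a ball. -/
def netSpan (ι : Type) [Fintype ι] (R : ℝ) :
    Submodule ℝ C(Metric.closedBall (0 : ι → ℝ) R, ℝ) :=
  Submodule.span ℝ (Set.range fun q : (ι → ℝ) × ℝ => ridge R relu continuous_relu q.1 q.2)

/-- The exponentials of linear functionals, as a homomorphism. -/
def expHom (ι : Type) [Fintype ι] (R : ℝ) :
    Multiplicative (ι → ℝ) →* C(Metric.closedBall (0 : ι → ℝ) R, ℝ) where
  toFun w := ridge R Real.exp Real.continuous_exp w.toAdd 0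
  map_one' := by ext x; simp [ridge]
  map_mul' v w := by ext x; simp [ridge, Real.exp_add, add_dotProduct]

theorem comp_mem_netSpan {R : ℝ} {f : ℝ → ℝ} (hf : f ∈ reluSpan) (w : ι → ℝ) :
    ∃ F ∈ netSpan ι R, ∀ x, F x = f (w ⬝ᵥ x.1) := by
  induction hf using Submodule.span_induction with
  | mem f h =>
    obtain ⟨⟨a, b⟩, rfl⟩ := h
    exact ⟨_, Submodule.subset_span ⟨(a • w, b), rfl⟩, fun x => by simp [ridge]⟩
  | zero => exact ⟨0, zero_mem _, fun x => by simp⟩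
  | add f g _ _ hf hg =>
    obtain ⟨F, hF, hF'⟩ := hf
    obtain ⟨G, hG, hG'⟩ := hg
    exact ⟨F + G, add_mem hF hG, fun x => by simp [hF', hG']⟩
  | smul c f _ hf =>
    obtain ⟨F, hF, hF'⟩ := hf
    exact ⟨c • F, Submodule.smul_mem _ _ hF, fun x => by simp [hF']⟩

theorem abs_dotProduct_le (w x : ι → ℝ) {R : ℝ} (hx : ‖x‖ ≤ R) : |w ⬝ᵥ x| ≤ (∑ i, |w i|) * R := by
  rw [dotProduct, Finset.sum_mul]
  refine (Finset.abs_sum_le_sum_abs _ _).trans (Finset.sum_le_sum fun i _ => ?_)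
  rw [abs_mul]
  exact mul_le_mul_of_nonneg_left ((norm_le_pi_norm x i).trans hx) (abs_nonneg _)

/-- On the ball the linear functional takes values in a bounded interval, where a univariate network
approximates the exponential. -/
theorem expHom_mem_closure (R : ℝ) (w : Multiplicative (ι → ℝ)) :
    expHom ι R w ∈ (netSpan ι R).topologicalClosure := by
  rw [← SetLike.mem_coe, Submodule.topologicalClosure_coe, Metric.mem_closure_iff]
  intro ε hε
  obtain ⟨f, hf, h⟩ := exists_reluSpan_near Real.exp Real.continuous_exp
    ((∑ i, |w.toAdd i|) * R) (half_pos hε)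
  obtain ⟨F, hF, hF'⟩ := comp_mem_netSpan (R := R) hf w.toAdd
  refine ⟨F, hF, lt_of_le_of_lt ((ContinuousMap.dist_le (half_pos hε).le).2 fun x => ?_)
    (half_lt_self hε)⟩
  rw [dist_comm, Real.dist_eq, hF']
  simpa [expHom, ridge] using h _ (abs_dotProduct_le w.toAdd x.1 (mem_closedBall_zero_iff.1 x.2))

/-- Products of ReLU networks are not networks, so Stone-Weierstrass is applied to exponentials of
linear functionals. These form a monoid, so the algebra they generate is their linear span, and that
lies in the closure of the networks. -/
theorem netSpan_topologicalClosure (R : ℝ) : (netSpan ι R).topologicalClosure = ⊤ := by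
  set E := Algebra.adjoin ℝ (MonoidHom.mrange (expHom ι R) :
    Set C(Metric.closedBall (0 : ι → ℝ) R, ℝ)) with hE
  have hsep : E.SeparatesPoints := by
    classical
    intro x y hxy
    obtain ⟨i, hi⟩ := Function.ne_iff.1 (Subtype.coe_injective.ne hxy)
    refine ⟨_, ⟨expHom ι R (Multiplicative.ofAdd (Pi.single i 1)),
      Algebra.subset_adjoin ⟨_, rfl⟩, rfl⟩, ?_⟩
    simpa [expHom, ridge] using hi
  have htop := ContinuousMap.subalgebra_topologicalClosure_eq_top_of_separatesPoints E hsep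
  have hle : Subalgebra.toSubmodule E ≤ (netSpan ι R).topologicalClosure := by
    rw [hE, Algebra.adjoin_eq_span, Submonoid.closure_eq, Submodule.span_le]
    rintro _ ⟨w, rfl⟩
    exact expHom_mem_closure R w
  refine eq_top_iff.2 fun g _ => ?_
  have hg : g ∈ closure (E : Set C(Metric.closedBall (0 : ι → ℝ) R, ℝ)) := by
    rw [← Subalgebra.topologicalClosure_coe, htop]; trivial
  exact closure_minimal (s := (E : Set _)) hle (netSpan ι R).isClosed_topologicalClosure hg

theorem exists_net_near_scalar (g : (ι → ℝ) → ℝ) (hg : Continuous g) (R : ℝ) {ε : ℝ}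
    (hε : 0 < ε) :
    ∃ (n : ℕ) (c : Fin n → ℝ) (w : Fin n → ι → ℝ) (b : Fin n → ℝ), ∀ x, ‖x‖ ≤ R →
      |∑ i, c i * relu (w i ⬝ᵥ x + b i) - g x| ≤ ε := by
  have hmem : (⟨fun x => g x.1, by fun_prop⟩ : C(Metric.closedBall (0 : ι → ℝ) R, ℝ)) ∈
      (netSpan ι R).topologicalClosure := by
    rw [netSpan_topologicalClosure]; trivial
  rw [← SetLike.mem_coe, Submodule.topologicalClosure_coe, Metric.mem_closure_iff] at hmem
  obtain ⟨F, hF, hd⟩ := hmem ε hε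
  obtain ⟨n, c, q, rfl⟩ := Submodule.mem_span_set'.1 hF
  choose q' hq' using fun i => (q i).2
  refine ⟨n, c, fun i => (q' i).1, fun i => (q' i).2, fun x hx => ?_⟩
  have := (ContinuousMap.dist_lt_iff hε).1 hd ⟨x, mem_closedBall_zero_iff.2 hx⟩
  rw [dist_comm, Real.dist_eq] at this
  simpa [← hq', ridge] using this.le

/-- The maps on tokens computed by a shallow ReLU network with a residual connection. -/
def IsNet (f : (ι → ℝ) → ι → ℝ) : Prop :=
  ∃ (n : ℕ) (W₁ : Matrix (Fin n) ι ℝ) (b₁ : Fin n → ℝ) (W₂ : Matrix ι (Fin n) ℝ),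
    ∀ x r, f x r = x r + ∑ i, W₂ r i * relu (W₁ i ⬝ᵥ x + b₁ i)

theorem isNet_id : IsNet (id : (ι → ℝ) → ι → ℝ) :=
  ⟨0, 0, 0, 0, fun x r => by simp⟩

theorem exists_isNet_near (g : (ι → ℝ) → ι → ℝ) (hg : Continuous g) (R : ℝ) {ε : ℝ} (hε : 0 < ε) :
    ∃ f, IsNet f ∧ ∀ x, ‖x‖ ≤ R → ‖f x - g x‖ ≤ ε := by
  classical
  -- The residual connection supplies `x`, so the network has to produce only the difference.
  choose n c w b h using fun r => exists_net_near_scalar (fun x => g x r - x r)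
    (by fun_prop) R hε
  -- The scalar networks of the coordinates run side by side on disjoint sets of neurons; `W₂` sends
  -- each neuron to its own coordinate only.
  let e : (Σ r, Fin (n r)) ≃ Fin (Fintype.card (Σ r, Fin (n r))) := Fintype.equivFin _
  refine ⟨_, ⟨_, Matrix.of fun i => w _ (e.symm i).2, fun i => b _ (e.symm i).2,
    Matrix.of fun r i => if (e.symm i).1 = r then c _ (e.symm i).2 else 0, fun _ _ => rfl⟩,
    fun x hx => (pi_norm_le_iff_of_nonneg hε.le).2 fun r => ?_⟩
  have := h r x hx
  rw [Real.norm_eq_abs, Pi.sub_apply]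
  convert this using 2
  have hsum := e.symm.sum_comp fun q : Σ r, Fin (n r) =>
    (if q.1 = r then c q.1 q.2 else 0) * relu (w q.1 q.2 ⬝ᵥ x + b q.1 q.2)
  rw [Fintype.sum_sigma, Finset.sum_eq_single r (fun r' _ hr => by simp [hr]) (by simp)] at hsum
  simp only [if_true] at hsum
  rw [← hsum]
  rw [sub_sub_eq_add_sub, add_comm]
  rfl

/-! ### Error propagation -/

theorem exists_bound_of_continuous {E : Type} [NormedAddCommGroup E] (g : (ι → ℝ) → E)
    (hg : Continuous g) (R : ℝ) : ∃ R', ∀ x, ‖x‖ ≤ R → ‖g x‖ ≤ R' := by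
  obtain ⟨C, hC⟩ := (isCompact_closedBall (0 : ι → ℝ) R).exists_bound_of_continuousOn
    hg.continuousOn
  exact ⟨C, fun x hx => hC x (mem_closedBall_zero_iff.2 hx)⟩

/-- Only the exact point is assumed to lie in the ball; δ ≤ 1 keeps the perturbed point in the ball
of radius `R + 1`, where `g` is uniformly continuous. -/
theorem exists_modulus (g : (ι → ℝ) → ι → ℝ) (hg : Continuous g) (R : ℝ) {ε : ℝ} (hε : 0 < ε) :
    ∃ δ > 0, δ ≤ 1 ∧ ∀ x x', ‖x'‖ ≤ R → ‖x - x'‖ ≤ δ → ‖g x - g x'‖ ≤ ε := by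
  obtain ⟨δ, hδ, h⟩ := Metric.uniformContinuousOn_iff.1
    ((isCompact_closedBall (0 : ι → ℝ) (R + 1)).uniformContinuousOn_of_continuous hg.continuousOn)
    ε hε
  refine ⟨min (δ / 2) 1, lt_min (half_pos hδ) one_pos, min_le_right _ _, fun x x' hx' hd => ?_⟩
  have h1 : ‖x‖ ≤ R + 1 := by
    calc ‖x‖ = ‖x' + (x - x')‖ := by rw [add_sub_cancel]
      _ ≤ R + 1 := (norm_add_le _ _).trans (add_le_add hx' (hd.trans (min_le_right _ _)))
  have := h x (mem_closedBall_zero_iff.2 h1) x' (mem_closedBall_zero_iff.2 (by linarith))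
    (by rw [dist_eq_norm]; exact (hd.trans (min_le_left _ _)).trans_lt (half_lt_self hδ))
  rw [dist_eq_norm] at this
  exact this.le

/-- The first step is peeled off. It moves the ball to one of another radius, so the induction runs
over all `R` and ε. The tolerances are chosen before `f`, which lets a network be picked afterwards.
-/
theorem iterate_near (g : (ι → ℝ) → ι → ℝ) (hg : Continuous g) (T : ℕ) :
    ∀ R : ℝ, ∀ ε > 0, ∃ R', ∃ μ > 0, ∃ δ > 0, ∀ f : (ι → ℝ) → ι → ℝ,
      (∀ x, ‖x‖ ≤ R' → ‖f x - g x‖ ≤ μ) → ∀ t ≤ T, ∀ x x', ‖x'‖ ≤ R → ‖x - x'‖ ≤ δ →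
        ‖f^[t] x - g^[t] x'‖ ≤ ε := by
  induction T with
  | zero =>
    intro R ε hε
    refine ⟨0, 1, one_pos, ε, hε, fun f _ t ht x x' _ h => ?_⟩
    obtain rfl : t = 0 := by omega
    exact h
  | succ T ih =>
    intro R ε hε
    obtain ⟨R₁, hR₁⟩ := exists_bound_of_continuous g hg R
    obtain ⟨R', μ, hμ, δ, hδ, h⟩ := ih R₁ ε hε
    obtain ⟨δ', hδ', hδ1, hmod⟩ := exists_modulus g hg R (half_pos hδ)
    refine ⟨max R' (R + 1), min μ (δ / 2), lt_min hμ (half_pos hδ), min δ' ε, lt_min hδ' hε,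
      fun f hf t ht x x' hx' hd => ?_⟩
    cases t with
    | zero => exact hd.trans (min_le_right _ _)
    | succ t =>
      rw [Function.iterate_succ_apply, Function.iterate_succ_apply]
      refine h f (fun z hz => (hf z (hz.trans (le_max_left _ _))).trans (min_le_left _ _)) t
        (by omega) _ _ (hR₁ x' hx') ?_
      have h1 : ‖x‖ ≤ R + 1 := by
        calc ‖x‖ = ‖x' + (x - x')‖ := by rw [add_sub_cancel]
          _ ≤ R + 1 := (norm_add_le _ _).trans
            (add_le_add hx' ((hd.trans (min_le_left _ _)).trans hδ1))
      calc ‖f x - g x'‖ = ‖(f x - g x) + (g x - g x')‖ := by rw [sub_add_sub_cancel]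
        _ ≤ δ / 2 + δ / 2 := (norm_add_le _ _).trans (add_le_add
          ((hf x (h1.trans (le_max_right _ _))).trans (min_le_right _ _))
          (hmod x x' hx' (hd.trans (min_le_left _ _))))
        _ = δ := add_halves δ

/-- A net that approximates the iterates of a continuous map, also at perturbed arguments. -/
theorem exists_isNet_iterate_near (g : (ι → ℝ) → ι → ℝ) (hg : Continuous g) (T : ℕ) (R : ℝ) {ε : ℝ}
    (hε : 0 < ε) :
    ∃ f, IsNet f ∧ ∃ δ > 0, ∀ t ≤ T, ∀ x x', ‖x'‖ ≤ R → ‖x - x'‖ ≤ δ →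
      ‖f^[t] x - g^[t] x'‖ ≤ ε := by
  obtain ⟨R', μ, hμ, δ, hδ, h⟩ := iterate_near g hg T R ε hε
  obtain ⟨f, hf, hfg⟩ := exists_isNet_near g hg R' hμ
  exact ⟨f, hf, δ, hδ, h f hfg⟩

theorem exists_isNet_robust_near (g : (ι → ℝ) → ι → ℝ) (hg : Continuous g) (R : ℝ) {ε : ℝ}
    (hε : 0 < ε) :
    ∃ f, IsNet f ∧ ∃ δ > 0, ∀ x x', ‖x'‖ ≤ R → ‖x - x'‖ ≤ δ → ‖f x - g x'‖ ≤ ε := by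
  obtain ⟨f, hf, δ, hδ, h⟩ := exists_isNet_iterate_near g hg 1 R hε
  exact ⟨f, hf, δ, hδ, h 1 le_rfl⟩

/-! ### Layers with uniform attention -/

/-- The mean of the tokens. -/
def mean {τ : Type} [Fintype τ] (X : Matrix ι τ ℝ) : ι → ℝ :=
  fun r => (Fintype.card τ : ℝ)⁻¹ * ∑ c, X r c

/-- Zero keys and queries make softmax uniform, so attention averages. Head `0` carries `V` and the
other heads have value matrix zero. -/
theorem exists_layer {h : ℕ} [NeZero h] {f : (ι → ℝ) → ι → ℝ} (hf : IsNet f) (V : Matrix ι ι ℝ) :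
    ∃ l : Layer ι h, ∀ (τ : Type) [Fintype τ] (X : Matrix ι τ ℝ) (c : τ),
      (l.eval X).col c = f (X.col c + V.mulVec (mean X)) := by
  obtain ⟨n, W₁, b₁, W₂, hf⟩ := hf
  refine ⟨⟨Pi.single 0 V, 0, 0, n, W₁, b₁, W₂, 0⟩, fun τ _ X c => ?_⟩
  set l : Layer ι h := ⟨Pi.single 0 V, 0, 0, n, W₁, b₁, W₂, 0⟩ with hl
  have hattn : (l.attn X).col c = X.col c + V.mulVec (mean X) := by
    funext r
    have hsm : softmax (0 : Matrix τ τ ℝ) = Matrix.of fun _ _ => (Fintype.card τ : ℝ)⁻¹ := by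
      ext i j; simp [softmax]
    simp only [Layer.attn, hl, Matrix.col_apply, Matrix.add_apply, Pi.zero_apply, Pi.add_apply,
      Matrix.transpose_zero, Matrix.mul_zero, Matrix.zero_mul, hsm]
    have hV : ∑ i, (Pi.single 0 V : Fin h → Matrix ι ι ℝ) i = V := by simp
    rw [← Matrix.sum_mul, ← Matrix.sum_mul, hV, Matrix.mul_assoc, Matrix.mul_apply, Matrix.mulVec,
      dotProduct]
    simp [Matrix.mul_apply, mean, Finset.sum_mul, Finset.mul_sum, mul_comm]
  funext r
  rw [hf, ← hattn]
  simp [Layer.eval, hl, Matrix.mul_apply, dotProduct]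
  rfl

theorem exists_tokenwise_layer {h : ℕ} [NeZero h] {f : (ι → ℝ) → ι → ℝ} (hf : IsNet f) :
    ∃ l : Layer ι h, ∀ (τ : Type) [Fintype τ] (X : Matrix ι τ ℝ) (c : τ),
      (l.eval X).col c = f (X.col c) := by
  obtain ⟨l, hl⟩ := exists_layer (h := h) hf 0
  exact ⟨l, fun τ _ X c => by simp [hl]⟩

end Universal

/-! ### Boundedness of the chains -/

theorem leaky_eq (α z : ℝ) : leaky α z = max z 0 - α * max (-z) 0 := by
  unfold leaky
  split_ifs with h
  · simp [h]
  · rw [max_eq_right (not_le.1 h).le, max_eq_left (by linarith)]; ring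

theorem leakyInv_eq (α z : ℝ) : leakyInv α z = max z 0 - max (-z) 0 / α := by
  unfold leakyInv
  split_ifs with h
  · simp [h]
  · rw [max_eq_right (not_le.1 h).le, max_eq_left (by linarith)]; ring

theorem continuous_leaky (α : ℝ) : Continuous (leaky α) := by
  rw [funext (leaky_eq α)]; fun_prop

theorem continuous_leakyInv (α : ℝ) : Continuous (leakyInv α) := by
  rw [funext (leakyInv_eq α)]; fun_prop

theorem abs_leaky_sub_le {α : ℝ} (hα : 0 < α) (x y : ℝ) :
    |leaky α x - leaky α y| ≤ (1 + α) * |x - y| := by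
  have h1 := abs_max_sub_max_le_abs x y 0
  have h2 := abs_max_sub_max_le_abs (-x) (-y) 0
  rw [show -x - -y = -(x - y) by ring, abs_neg] at h2
  rw [leaky_eq, leaky_eq, show max x 0 - α * max (-x) 0 - (max y 0 - α * max (-y) 0)
    = (max x 0 - max y 0) - α * (max (-x) 0 - max (-y) 0) by ring]
  have h3 := abs_sub (max x 0 - max y 0) (α * (max (-x) 0 - max (-y) 0))
  rw [abs_mul, abs_of_pos hα] at h3
  linarith [mul_le_mul_of_nonneg_left h2 hα.le]

variable {d L N : ℕ}

theorem chain_succ (α : ℝ) (W : Fin L → Matrix (Fin d) (Fin d) ℝ) (x : Fin d → ℝ) (j : Fin L) :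
    chain α W x j.succ = fun a => leaky α ((W j).mulVec (chain α W x j.castSucc) a) := by
  simp [chain]

theorem abs_mulVec_le {A : Matrix (Fin d) (Fin d) ℝ} {v : Fin d → ℝ} {K M : ℝ}
    (hA : ∀ a b, |A a b| ≤ K) (hv : ∀ b, |v b| ≤ M) (a : Fin d) : |A.mulVec v a| ≤ d * (K * M) := by
  rw [Matrix.mulVec, dotProduct]
  refine (Finset.abs_sum_le_sum_abs _ _).trans ?_
  refine (Finset.sum_le_card_nsmul _ _ (K * M) fun b _ => ?_).trans_eq (by simp)
  rw [abs_mul]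
  exact mul_le_mul (hA a b) (hv b) (abs_nonneg _) ((abs_nonneg _).trans (hA a b))

/-- Each layer enlarges the bound by a factor depending only on `d`, `α` and `B`; summing the
absolute values of the layer bounds gives one constant for all states. -/
theorem exists_chain_bound (d L : ℕ) {α : ℝ} (hα : 0 < α) (B : ℝ) :
    ∃ M, 0 ≤ M ∧ ∀ (W : Fin L → Matrix (Fin d) (Fin d) ℝ) (x : Fin d → ℝ),
      (∀ j a b, |W j a b| ≤ B) → (∀ a, |x a| ≤ B) → ∀ j a, |chain α W x j a| ≤ M := by
  have key : ∀ j : Fin (L + 1), ∃ M, ∀ (W : Fin L → Matrix (Fin d) (Fin d) ℝ) (x : Fin d → ℝ),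
      (∀ j a b, |W j a b| ≤ B) → (∀ a, |x a| ≤ B) → ∀ a, |chain α W x j a| ≤ M := by
    intro j
    induction j using Fin.induction with
    | zero => exact ⟨B, fun W x _ hx a => hx a⟩
    | succ j ih =>
      obtain ⟨M, hM⟩ := ih
      refine ⟨(1 + α) * (d * (B * M)), fun W x hW hx a => ?_⟩
      have h1 := abs_leaky_sub_le hα ((W j).mulVec (chain α W x j.castSucc) a) 0
      rw [show leaky α 0 = 0 by simp [leaky], sub_zero, sub_zero] at h1
      rw [chain_succ]
      exact h1.trans (mul_le_mul_of_nonneg_left (abs_mulVec_le (hW j) (hM W x hW hx) a)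
        (by linarith))
  choose M hM using key
  refine ⟨∑ j, |M j|, by positivity, fun W x hW hx j a => (hM j W x hW hx a).trans ?_⟩
  exact (le_abs_self _).trans
    (Finset.single_le_sum (f := fun j => |M j|) (fun _ _ => abs_nonneg _) (Finset.mem_univ j))

/-! ### Convergence of gradient descent -/

/-- The empirical second moment matrix, as a linear map. -/
def moment (u : Fin N → Fin d → ℝ) (v : Fin d → ℝ) : Fin d → ℝ :=
  (1 / (N : ℝ)) • ∑ i, (u i ⬝ᵥ v) • u i

theorem moment_dotProduct (u : Fin N → Fin d → ℝ) (v w : Fin d → ℝ) :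
    moment u v ⬝ᵥ w = 1 / (N : ℝ) * ∑ i, (u i ⬝ᵥ v) * (u i ⬝ᵥ w) := by
  simp [moment, sum_dotProduct]

theorem moment_mem_span (u : Fin N → Fin d → ℝ) (v : Fin d → ℝ) :
    moment u v ∈ Submodule.span ℝ (Set.range u) :=
  Submodule.smul_mem _ _ (Submodule.sum_mem _ fun i _ =>
    Submodule.smul_mem _ _ (Submodule.subset_span ⟨i, rfl⟩))

/-- One step of gradient descent acts on the estimation error by this map (transposed). -/
def contraction (η : ℝ) (u : Fin N → Fin d → ℝ) (v : Fin d → ℝ) : Fin d → ℝ :=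
  v - η • moment u v

theorem contraction_sub_smul (η : ℝ) (u : Fin N → Fin d → ℝ) (c : ℝ) (v w : Fin d → ℝ) :
    contraction η u (c • v - w) = c • contraction η u v - contraction η u w := by
  simp only [contraction, moment, dotProduct_sub, dotProduct_smul, sub_smul,
    Finset.sum_sub_distrib, smul_sub, smul_assoc, ← Finset.smul_sum]
  rw [smul_comm c η, smul_comm c (1 / (N : ℝ))]
  abel

theorem contraction_dotProduct_comm (η : ℝ) (u : Fin N → Fin d → ℝ) (v w : Fin d → ℝ) :
    contraction η u v ⬝ᵥ w = contraction η u w ⬝ᵥ v := by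
  simp only [contraction, sub_dotProduct, smul_dotProduct, moment_dotProduct, dotProduct_comm v w]
  simp only [mul_comm]

/-- By Cauchy-Schwarz the second moment form is at most `M` times the squared norm, and `η * M ≤ 1`.
-/
theorem contraction_dotProduct_self_nonneg {η : ℝ} {u : Fin N → Fin d → ℝ} (hN : 0 < N)
    (hη : 0 < η) {M : ℝ} (hu : ∀ i, u i ⬝ᵥ u i ≤ M) (hM : η * M ≤ 1) (v : Fin d → ℝ) :
    0 ≤ contraction η u v ⬝ᵥ v := by
  have hN' : (0 : ℝ) < N := Nat.cast_pos.2 hN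
  have hv : 0 ≤ v ⬝ᵥ v := Finset.sum_nonneg fun i _ => mul_self_nonneg _
  have h : ∑ i, (u i ⬝ᵥ v) * (u i ⬝ᵥ v) ≤ N * (M * (v ⬝ᵥ v)) := by
    refine (Finset.sum_le_card_nsmul _ _ (M * (v ⬝ᵥ v)) fun i _ => ?_).trans_eq (by simp)
    have hcs := Finset.sum_mul_sq_le_sq_mul_sq Finset.univ (u i) v
    rw [← sq]
    refine le_trans (le_trans hcs (le_of_eq ?_)) (mul_le_mul_of_nonneg_right (hu i) hv)
    simp [dotProduct, sq]
  rw [contraction, sub_dotProduct, smul_dotProduct, moment_dotProduct, smul_eq_mul]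
  have h2 : 1 / (N : ℝ) * ∑ i, (u i ⬝ᵥ v) * (u i ⬝ᵥ v) ≤ M * (v ⬝ᵥ v) := by
    rw [one_div, inv_mul_le_iff₀ hN']; exact h
  nlinarith [mul_le_mul_of_nonneg_left h2 hη.le, mul_le_mul_of_nonneg_right hM hv]

theorem contraction_mem_span {η : ℝ} {u : Fin N → Fin d → ℝ} {v : Fin d → ℝ}
    (hv : v ∈ Submodule.span ℝ (Set.range u)) :
    contraction η u v ∈ Submodule.span ℝ (Set.range u) :=
  Submodule.sub_mem _ hv (Submodule.smul_mem _ _ (moment_mem_span u v))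

/-- A symmetric P with 0 ≤ P ≤ c on an invariant subspace has norm at most c there. Quadratic forms
suffice; no diagonalization is used. -/
theorem contraction_dotProduct_contraction_le {η κ : ℝ} {u : Fin N → Fin d → ℝ} (hN : 0 < N)
    (hη : 0 < η) {M : ℝ} (hu : ∀ i, u i ⬝ᵥ u i ≤ M) (hM : η * M ≤ 1)
    (hκ : ∀ v ∈ Submodule.span ℝ (Set.range u), κ * (v ⬝ᵥ v) ≤ 1 / (N : ℝ) * ∑ i, (u i ⬝ᵥ v) ^ 2)
    {v : Fin d → ℝ} (hv : v ∈ Submodule.span ℝ (Set.range u)) :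
    contraction η u v ⬝ᵥ contraction η u v ≤ Real.exp (-(η * κ)) ^ 2 * (v ⬝ᵥ v) := by
  -- Taken instead of 1 - ηκ, which it dominates, because it is always positive and can be
  -- cancelled; 1 - ηκ may be negative when the span is zero.
  set c := Real.exp (-(η * κ)) with hc
  have hc0 : 0 < c := Real.exp_pos _
  have hle : ∀ w ∈ Submodule.span ℝ (Set.range u), contraction η u w ⬝ᵥ w ≤ c * (w ⬝ᵥ w) := by
    intro w hw
    have hw0 : 0 ≤ w ⬝ᵥ w := Finset.sum_nonneg fun i _ => mul_self_nonneg _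
    have h1 := mul_le_mul_of_nonneg_left (hκ w hw) hη.le
    have h2 : 1 - η * κ ≤ c := by linarith [Real.add_one_le_exp (-(η * κ))]
    rw [contraction, sub_dotProduct, smul_dotProduct, moment_dotProduct, smul_eq_mul]
    simp only [← sq]
    nlinarith [mul_le_mul_of_nonneg_right h2 hw0]
  set w := contraction η u v with hw
  -- With w = Pv and symmetry this expands to 2c⟨w, w⟩ ≤ c²⟨w, v⟩ + ⟨Pw, w⟩. The right side is at
  -- most c³⟨v, v⟩ + c⟨w, w⟩.
  have hpos := contraction_dotProduct_self_nonneg hN hη hu hM (c • v - w)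
  rw [contraction_sub_smul, ← hw] at hpos
  have hcomm : contraction η u w ⬝ᵥ v = w ⬝ᵥ w := contraction_dotProduct_comm η u w v
  simp only [sub_dotProduct, dotProduct_sub, smul_dotProduct, dotProduct_smul, smul_eq_mul, hcomm]
    at hpos
  have h1 := mul_le_mul_of_nonneg_left (hle v hv) (mul_pos hc0 hc0).le
  have h2 := hle w (contraction_mem_span hv)
  rw [← hw] at h1
  have h3 : c * (w ⬝ᵥ w) ≤ c * (c ^ 2 * (v ⬝ᵥ v)) := by nlinarith
  exact le_of_mul_le_mul_left h3 hc0

/-- For exact linear targets the gradient is (A - W)Σ, so a step multiplies the error by I - ηΣ on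
the right. This turns matrix iterates into iterates applied to the vector. -/
theorem sub_lossGrad_mulVec {u y : Fin N → Fin d → ℝ} {A W : Matrix (Fin d) (Fin d) ℝ}
    (hy : ∀ i, y i = W.mulVec (u i)) (η : ℝ) (v : Fin d → ℝ) :
    (A - η • lossGrad u y A - W).mulVec v = (A - W).mulVec (contraction η u v) := by
  have hg : (lossGrad u y A).mulVec v = (A - W).mulVec (moment u v) := by
    funext a
    rw [moment, Matrix.mulVec_smul, Matrix.mulVec_sum]
    simp only [Matrix.mulVec_smul, Pi.smul_apply, Finset.sum_apply, smul_eq_mul]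
    have hr : ∀ i, A.mulVec (u i) a - y i a = (A - W).mulVec (u i) a := fun i => by
      rw [hy, Matrix.sub_mulVec, Pi.sub_apply]
    rw [Matrix.mulVec, dotProduct]
    simp only [lossGrad, Matrix.of_apply, hr, dotProduct, Finset.mul_sum, Finset.sum_mul]
    rw [Finset.sum_comm]
    exact Finset.sum_congr rfl fun i _ => Finset.sum_congr rfl fun b _ => by ring
  rw [contraction, Matrix.mulVec_sub, Matrix.mulVec_smul, ← hg, Matrix.sub_mulVec,
    Matrix.sub_mulVec, Matrix.sub_mulVec, Matrix.smul_mulVec]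
  abel

theorem gradDescent_sub_mulVec {u y : Fin N → Fin d → ℝ} {A₀ W : Matrix (Fin d) (Fin d) ℝ}
    (hy : ∀ i, y i = W.mulVec (u i)) (η : ℝ) (t : ℕ) (v : Fin d → ℝ) :
    (gradDescent u y η A₀ t - W).mulVec v = (A₀ - W).mulVec ((contraction η u)^[t] v) := by
  induction t generalizing v with
  | zero => rfl
  | succ t ih =>
    rw [gradDescent, sub_lossGrad_mulVec hy, ih, Function.iterate_succ_apply]

theorem iterate_contraction_le {η κ : ℝ} {u : Fin N → Fin d → ℝ} (hN : 0 < N)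
    (hη : 0 < η) {M : ℝ} (hu : ∀ i, u i ⬝ᵥ u i ≤ M) (hM : η * M ≤ 1)
    (hκ : ∀ v ∈ Submodule.span ℝ (Set.range u), κ * (v ⬝ᵥ v) ≤ 1 / (N : ℝ) * ∑ i, (u i ⬝ᵥ v) ^ 2)
    {v : Fin d → ℝ} (hv : v ∈ Submodule.span ℝ (Set.range u)) (t : ℕ) :
    (contraction η u)^[t] v ⬝ᵥ (contraction η u)^[t] v
      ≤ Real.exp (-(η * κ * t)) ^ 2 * (v ⬝ᵥ v) := by
  induction t generalizing v with
  | zero => simp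
  | succ t ih =>
    rw [Function.iterate_succ_apply]
    refine (ih (contraction_mem_span hv)).trans ((mul_le_mul_of_nonneg_left
      (contraction_dotProduct_contraction_le hN hη hu hM hκ hv) (sq_nonneg _)).trans_eq ?_)
    rw [← mul_assoc, ← mul_pow, ← Real.exp_add]
    push_cast
    ring_nf

theorem dotProduct_self_le {v : Fin d → ℝ} {M : ℝ} (hv : ∀ a, |v a| ≤ M) : v ⬝ᵥ v ≤ d * M ^ 2 := by
  refine (Finset.sum_le_card_nsmul _ _ (M ^ 2) fun a _ => ?_).trans_eq (by simp)
  rw [← sq, ← sq_abs]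
  exact pow_le_pow_left₀ (abs_nonneg _) (hv a) 2

/-- The estimate need not converge to `W`: only its action on the span of the samples does. The
factor `Real.sqrt d * M` bounds the Euclidean norm of `v`. -/
theorem abs_gradDescent_sub_le {η κ : ℝ} {u y : Fin N → Fin d → ℝ}
    {A₀ W : Matrix (Fin d) (Fin d) ℝ} (hN : 0 < N) (hη : 0 < η) {K M : ℝ} (hM0 : 0 ≤ M)
    (hy : ∀ i, y i = W.mulVec (u i)) (hu : ∀ i a, |u i a| ≤ M) (hM : η * (d * M ^ 2) ≤ 1)
    (hW : ∀ a b, |(A₀ - W) a b| ≤ K)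
    (hκ : ∀ v ∈ Submodule.span ℝ (Set.range u), κ * (v ⬝ᵥ v) ≤ 1 / (N : ℝ) * ∑ i, (u i ⬝ᵥ v) ^ 2)
    {v : Fin d → ℝ} (hv : v ∈ Submodule.span ℝ (Set.range u)) (hvM : ∀ a, |v a| ≤ M)
    (t : ℕ) (a : Fin d) :
    |(gradDescent u y η A₀ t).mulVec v a - W.mulVec v a|
      ≤ d * (K * (Real.exp (-(η * κ * t)) * (Real.sqrt d * M))) := by
  rw [← Pi.sub_apply, ← Matrix.sub_mulVec, gradDescent_sub_mulVec hy]
  refine abs_mulVec_le hW (fun b => ?_) a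
  set w := (contraction η u)^[t] v
  have h1 := iterate_contraction_le hN hη (fun i => dotProduct_self_le (hu i)) hM hκ hv t
  have h2 : w b ^ 2 ≤ w ⬝ᵥ w := by
    rw [sq]
    exact Finset.single_le_sum (f := fun b => w b * w b) (fun b _ => mul_self_nonneg _)
      (Finset.mem_univ b)
  refine abs_le_of_sq_le_sq (h2.trans (h1.trans ?_)) (by positivity)
  rw [mul_pow, mul_pow, Real.sq_sqrt (Nat.cast_nonneg _)]
  exact mul_le_mul_of_nonneg_left (dotProduct_self_le hvM) (sq_nonneg _)

/-! ### Two layers with one averaging step -/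

section TwoLayers

variable {ι : Type} [Fintype ι]

theorem exists_norm_mulVec_le (V : Matrix ι ι ℝ) : ∃ K, 0 ≤ K ∧ ∀ z, ‖V.mulVec z‖ ≤ K * ‖z‖ := by
  refine ⟨∑ r, ∑ r', |V r r'|, by positivity, fun z => ?_⟩
  refine (pi_norm_le_iff_of_nonneg (by positivity)).2 fun r => ?_
  refine (abs_dotProduct_le (V r) z le_rfl).trans (mul_le_mul_of_nonneg_right ?_ (norm_nonneg _))
  exact Finset.single_le_sum (f := fun r => ∑ r', |V r r'|) (fun r _ => by positivity)
    (Finset.mem_univ r)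

/-- Averaging does not amplify errors, whatever the number of tokens; hence one choice of parameters
serves prompts of every length. -/
theorem norm_mean_le {τ : Type} [Fintype τ] {X : Matrix ι τ ℝ} {b : ℝ} (hb : 0 ≤ b)
    (h : ∀ c, ‖X.col c‖ ≤ b) : ‖mean X‖ ≤ b := by
  refine (pi_norm_le_iff_of_nonneg hb).2 fun r => ?_
  have hs : |∑ c, X r c| ≤ Fintype.card τ * b :=
    (Finset.abs_sum_le_sum_abs _ _).trans ((Finset.sum_le_card_nsmul _ _ b fun c _ =>
      (norm_le_pi_norm (X.col c) r).trans (h c)).trans_eq (by simp))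
  rw [mean, Real.norm_eq_abs, abs_mul, abs_of_nonneg (by positivity)]
  rcases Nat.eq_zero_or_pos (Fintype.card τ) with h0 | h0
  · simp [h0, hb]
  · rwa [inv_mul_le_iff₀ (Nat.cast_pos.2 h0)]

omit [Fintype ι] in
theorem mean_sub {τ : Type} [Fintype τ] (X Y : Matrix ι τ ℝ) : mean (X - Y) = mean X - mean Y := by
  funext r; simp [mean, mul_sub]

/-- The token `c` after a tokenwise map `g` and uniform attention with value matrix `V`. -/
def gather {τ : Type} [Fintype τ] (g : (ι → ℝ) → ι → ℝ) (V : Matrix ι ι ℝ) (X : Matrix ι τ ℝ)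
    (c : τ) : ι → ℝ :=
  g (X.col c) + V.mulVec (mean (Matrix.of fun r c => g (X.col c) r))

theorem exists_layers_near {g₀ g₁ : (ι → ℝ) → ι → ℝ} (hg₀ : Continuous g₀) (hg₁ : Continuous g₁)
    (V : Matrix ι ι ℝ) (h : ℕ) [NeZero h] (R : ℝ) {ε : ℝ} (hε : 0 < ε) :
    ∃ l₀ l₁ : Layer ι h, ∀ (τ : Type) [Fintype τ] (X : Matrix ι τ ℝ), (∀ c, ‖X.col c‖ ≤ R) →
      ∀ c, ‖(l₁.eval (l₀.eval X)).col c - g₁ (gather g₀ V X c)‖ ≤ ε := by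
  obtain ⟨K, hK, hV⟩ := exists_norm_mulVec_le V
  obtain ⟨R₀, hR₀⟩ := exists_bound_of_continuous g₀ hg₀ R
  obtain ⟨f₁, hf₁, δ, hδ, h₁⟩ := exists_isNet_robust_near g₁ hg₁ (R₀ + K * R₀) hε
  -- An error of the first net reaches the second one directly and, times at most `K`, through the
  -- mean: a factor `1 + K` in total.
  obtain ⟨f₀, hf₀, h₀⟩ := exists_isNet_near g₀ hg₀ R (div_pos hδ (by positivity : 0 < 1 + K))
  obtain ⟨l₀, hl₀⟩ := exists_tokenwise_layer (h := h) hf₀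
  obtain ⟨l₁, hl₁⟩ := exists_layer (h := h) hf₁ V
  refine ⟨l₀, l₁, fun τ _ X hX c => ?_⟩
  set G : Matrix ι τ ℝ := Matrix.of fun r c => g₀ (X.col c) r with hG
  have hGb : ∀ c, ‖G.col c‖ ≤ R₀ := fun c => hR₀ _ (hX c)
  have hR₀' : 0 ≤ R₀ := (norm_nonneg _).trans (hGb c)
  have hd : ∀ c, ‖(l₀.eval X - G).col c‖ ≤ δ / (1 + K) := fun c => by
    have : (l₀.eval X - G).col c = f₀ (X.col c) - g₀ (X.col c) := by
      rw [← hl₀]; rfl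
    rw [this]; exact h₀ _ (hX c)
  have hd0 : 0 ≤ δ / (1 + K) := (div_pos hδ (by positivity)).le
  rw [hl₁]
  refine h₁ _ _ ?_ ?_
  · refine (norm_add_le _ _).trans (add_le_add (hGb c) ((hV _).trans ?_))
    exact mul_le_mul_of_nonneg_left (norm_mean_le hR₀' hGb) hK
  · have : (l₀.eval X).col c + V.mulVec (mean (l₀.eval X)) - gather g₀ V X c
        = (l₀.eval X - G).col c + V.mulVec (mean (l₀.eval X - G)) := by
      rw [mean_sub, Matrix.mulVec_sub, gather]
      funext r
      simp [hG]
      ring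
    rw [this]
    calc _ ≤ δ / (1 + K) + K * (δ / (1 + K)) := (norm_add_le _ _).trans (add_le_add (hd c)
          ((hV _).trans (mul_le_mul_of_nonneg_left (norm_mean_le hd0 hd) hK)))
      _ = δ := by field_simp

end TwoLayers

/-! ### The layout of the scratch coordinates -/

/-- The places of the tokens in the longest prompt. -/
abbrev Slot (N L : ℕ) : Type := (Fin N × Fin (L + 1)) ⊕ Fin (L + 1)

/-- The scratch coordinates: two copies of the prompt, of which the first holds a one-hot encoding of
the place and the state of the token itself and the second collects them for all tokens, and after
the filtering the regressors, the targets, the estimate of the weight matrix, and the target of the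
token itself. -/
abbrev Scratch (d N L : ℕ) : Type :=
  ((Slot N L × Option (Fin d)) ⊕ (Slot N L × Option (Fin d))) ⊕
    ((Fin N × Fin d) ⊕ (Fin N × Fin d)) ⊕ (Fin d × Fin d) ⊕ Fin d

/-- The tokens. -/
abbrev Token (d N L : ℕ) : Type := Row d (Fintype.card (Scratch d N L)) → ℝ

namespace Token

/-- The coordinate that holds a scratch value. -/
def scratch (s : Scratch d N L) : Row d (Fintype.card (Scratch d N L)) :=
  Sum.inr (Fintype.equivFin _ s)

/-- The token with given core and scratch values. -/
def mk (core : CoreRow d → ℝ) (f : Scratch d N L → ℝ) : Token d N L :=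
  Sum.elim core fun b => f ((Fintype.equivFin _).symm b)

@[simp] theorem mk_inl (core : CoreRow d → ℝ) (f : Scratch d N L → ℝ) (r : CoreRow d) :
    mk core f (Sum.inl r) = core r := rfl

@[simp] theorem mk_scratch (core : CoreRow d → ℝ) (f : Scratch d N L → ℝ) (s : Scratch d N L) :
    mk core f (scratch s) = f s := by
  simp [mk, scratch]

theorem continuous_mk {X : Type} [TopologicalSpace X] {core : X → CoreRow d → ℝ}
    {f : X → Scratch d N L → ℝ} (h₁ : Continuous core) (h₂ : Continuous f) :
    Continuous fun x => mk (core x) (f x) := by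
  refine continuous_pi fun r => ?_
  rcases r with r | b
  · exact (continuous_apply r).comp h₁
  · exact (continuous_apply ((Fintype.equivFin _).symm b)).comp h₂

/-- The core of a filtered token. The residual block is determined by the estimate `A`, the current
state and the regression target. -/
def filteredCore (cur next : Fin d → ℝ) (ind : Fin 3 → ℝ) (o : Fin d → ℝ)
    (A : Matrix (Fin d) (Fin d) ℝ) : CoreRow d → ℝ
  | Sum.inl (Sum.inl a) => cur a
  | Sum.inl (Sum.inr (Sum.inl a)) => next a
  | Sum.inl (Sum.inr (Sum.inr a)) => A.mulVec cur a - o a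
  | Sum.inr i => ind i

/-- The scratch values of a filtered token. -/
def filteredScratch (u y : Fin N → Fin d → ℝ) (o : Fin d → ℝ) (A : Matrix (Fin d) (Fin d) ℝ) :
    Scratch d N L → ℝ
  | Sum.inl _ => 0
  | Sum.inr (Sum.inl (Sum.inl (i, a))) => u i a
  | Sum.inr (Sum.inl (Sum.inr (i, a))) => y i a
  | Sum.inr (Sum.inr (Sum.inl (a, b))) => A a b
  | Sum.inr (Sum.inr (Sum.inr a)) => o a

/-- A filtered token. -/
def enc (cur next : Fin d → ℝ) (ind : Fin 3 → ℝ) (u y : Fin N → Fin d → ℝ) (o : Fin d → ℝ)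
    (A : Matrix (Fin d) (Fin d) ℝ) : Token d N L :=
  mk (filteredCore cur next ind o A) (filteredScratch u y o A)

theorem continuous_enc {X : Type} [TopologicalSpace X] {cur next o : X → Fin d → ℝ}
    {ind : X → Fin 3 → ℝ} {u y : X → Fin N → Fin d → ℝ} {A : X → Matrix (Fin d) (Fin d) ℝ}
    (hcur : Continuous cur) (hnext : Continuous next) (hind : Continuous ind) (hu : Continuous u)
    (hy : Continuous y) (ho : Continuous o) (hA : Continuous A) :
    Continuous fun x =>
      (enc (cur x) (next x) (ind x) (u x) (y x) (o x) (A x) : Token d N L) := by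
  refine continuous_mk (continuous_pi ?_) (continuous_pi ?_)
  · rintro ((a | a | a) | i) <;> simp only [filteredCore]
    · fun_prop
    · fun_prop
    · exact ((continuous_apply a).comp (hA.matrix_mulVec hcur)).sub ((continuous_apply a).comp ho)
    · fun_prop
  · rintro (s | (⟨i, a⟩ | ⟨i, a⟩) | ⟨a, b⟩ | a) <;> simp only [filteredScratch]
    · fun_prop
    · fun_prop
    · fun_prop
    · exact hA.matrix_elem a b
    · fun_prop

/-- A step of gradient descent on a filtered token. -/
def gradStep (η : ℝ) (x : Token d N L) : Token d N L :=
  let u : Fin N → Fin d → ℝ := fun i a => x (scratch (Sum.inr (Sum.inl (Sum.inl (i, a)))))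
  let y : Fin N → Fin d → ℝ := fun i a => x (scratch (Sum.inr (Sum.inl (Sum.inr (i, a)))))
  let A : Matrix (Fin d) (Fin d) ℝ :=
    Matrix.of fun a b => x (scratch (Sum.inr (Sum.inr (Sum.inl (a, b)))))
  enc (fun a => x (Sum.inl (CoreRow.cur a))) (fun a => x (Sum.inl (CoreRow.next a)))
    (fun i => x (Sum.inl (Sum.inr i))) u y (fun a => x (scratch (Sum.inr (Sum.inr (Sum.inr a)))))
    (A - η • lossGrad u y A)

theorem continuous_gradStep (η : ℝ) : Continuous (gradStep η : Token d N L → Token d N L) := by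
  refine continuous_enc ?_ ?_ ?_ ?_ ?_ ?_ ?_
  any_goals fun_prop
  refine continuous_matrix fun a b => ?_
  simp only [lossGrad, Matrix.sub_apply, Matrix.smul_apply, Matrix.of_apply, Matrix.mulVec,
    dotProduct]
  fun_prop

/-- The token carries the complete regression problem in its scratch coordinates, so the step needs
no other token; the residual block is recomputed from the new estimate. -/
theorem gradStep_enc (η : ℝ) (cur next : Fin d → ℝ) (ind : Fin 3 → ℝ) (u y : Fin N → Fin d → ℝ)
    (o : Fin d → ℝ) (A : Matrix (Fin d) (Fin d) ℝ) :
    gradStep η (enc cur next ind u y o A : Token d N L)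
      = enc cur next ind u y o (A - η • lossGrad u y A) := by
  simp only [gradStep, enc, mk_inl, mk_scratch, filteredCore, filteredScratch]
  rfl

theorem iterate_gradStep_enc (η : ℝ) (cur next : Fin d → ℝ) (ind : Fin 3 → ℝ)
    (u y : Fin N → Fin d → ℝ) (o : Fin d → ℝ) (A : Matrix (Fin d) (Fin d) ℝ) (t : ℕ) :
    (gradStep η)^[t] (enc cur next ind u y o A : Token d N L)
      = enc cur next ind u y o (gradDescent u y η A t) := by
  induction t with
  | zero => rfl
  | succ t ih => rw [Function.iterate_succ_apply', ih, gradStep_enc]; rfl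

/-- Leaky ReLU of the residual block, written to the next-state block. -/
def predict (α : ℝ) (x : Token d N L) : Token d N L :=
  mk (fun r => match r with
    | Sum.inl (Sum.inr (Sum.inl a)) => leaky α (x (Sum.inl (Sum.inl (Sum.inr (Sum.inr a)))))
    | r => x (Sum.inl r)) fun s => x (scratch s)

theorem continuous_predict (α : ℝ) : Continuous (predict α : Token d N L → Token d N L) := by
  refine continuous_mk (continuous_pi ?_) (by fun_prop)
  rintro ((a | a | a) | i)
  · fun_prop
  · exact (continuous_leaky α).comp (continuous_apply _)
  · fun_prop
  · fun_prop

/-! ### Collecting the prompt -/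

/-- The one-hot encoding of a place. -/
def oneHot (q : Slot N L) : Scratch d N L → ℝ
  | Sum.inl (Sum.inl (q', none)) => if q' = q then 1 else 0
  | _ => 0

/-- The state block of a token of the prompt. -/
def stateCore (v : Fin d → ℝ) : CoreRow d → ℝ
  | Sum.inl (Sum.inl a) => v a
  | _ => 0

/-- A token of the prompt. -/
def start (q : Slot N L) (v : Fin d → ℝ) : Token d N L := mk (stateCore v) (oneHot q)

theorem norm_start_le (q : Slot N L) {v : Fin d → ℝ} {M : ℝ} (hM : 0 ≤ M) (hv : ∀ a, |v a| ≤ M) :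
    ‖(start q v : Token d N L)‖ ≤ M + 1 := by
  refine (pi_norm_le_iff_of_nonneg (by positivity)).2 fun r => ?_
  rcases r with ((a | a | a) | i) | b
  · exact (hv a).trans (by linarith)
  · simp [start, stateCore]; positivity
  · simp [start, stateCore]; positivity
  · simp [start, stateCore]; positivity
  · change ‖oneHot q ((Fintype.equivFin _).symm b)‖ ≤ _
    unfold oneHot
    split
    · split_ifs <;> simp <;> linarith
    · simp; positivity

/-- The state is copied to the place of the token in the first copy of the prompt. -/
def spread (x : Token d N L) : Token d N L :=
  mk (fun r => x (Sum.inl r)) fun s => match s with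
    | Sum.inl (Sum.inl (q, some a)) =>
        x (scratch (Sum.inl (Sum.inl (q, none)))) * x (Sum.inl (CoreRow.cur a))
    | s => x (scratch s)

theorem continuous_spread : Continuous (spread : Token d N L → Token d N L) := by
  refine continuous_mk (by fun_prop) (continuous_pi ?_)
  rintro ((⟨q, _ | a⟩ | s) | s) <;> simp only <;> fun_prop

theorem scratch_injective :
    Function.Injective (scratch : Scratch d N L → Row d (Fintype.card (Scratch d N L))) :=
  Sum.inr_injective.comp (Equiv.injective _)

/-- The value matrix that moves the first copy of the prompt to the second. -/
def moveCopy (d N L : ℕ) : Matrix (Row d (Fintype.card (Scratch d N L)))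
    (Row d (Fintype.card (Scratch d N L))) ℝ :=
  Matrix.of fun r => mk (fun _ => 0) (fun s => match s with
    | Sum.inl (Sum.inl z) => if r = scratch (Sum.inl (Sum.inr z)) then 1 else 0
    | _ => 0)

theorem moveCopy_mulVec_apply (x : Token d N L) (r : Row d (Fintype.card (Scratch d N L))) :
    (moveCopy d N L).mulVec x r = ∑ z,
      (if r = scratch (Sum.inl (Sum.inr z)) then x (scratch (Sum.inl (Sum.inl z))) else 0) := by
  have h : ∑ s : Scratch d N L, moveCopy d N L r (scratch s) * x (scratch s)
      = ∑ b, moveCopy d N L r (Sum.inr b) * x (Sum.inr b) :=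
    (Fintype.equivFin (Scratch d N L)).sum_comp fun b =>
      moveCopy d N L r (Sum.inr b) * x (Sum.inr b)
  have h₀ : ∀ r', moveCopy d N L r (Sum.inl r') = 0 := fun _ => rfl
  have h₁ : ∀ z, moveCopy d N L r (scratch (Sum.inl (Sum.inl z)))
      = if r = scratch (Sum.inl (Sum.inr z)) then 1 else 0 := fun _ => by
    simp [moveCopy]
  have h₂ : ∀ z, moveCopy d N L r (scratch (Sum.inl (Sum.inr z))) = 0 := fun _ => by
    simp [moveCopy]
  have h₃ : ∀ z, moveCopy d N L r (scratch (Sum.inr z)) = 0 := fun _ => by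
    simp [moveCopy]
  rw [Matrix.mulVec, dotProduct, Fintype.sum_sum_type, ← h]
  simp only [h₀, zero_mul, Finset.sum_const_zero, zero_add]
  rw [Fintype.sum_sum_type, Fintype.sum_sum_type]
  simp only [h₁, h₂, h₃, zero_mul, Finset.sum_const_zero, add_zero, ite_mul, one_mul]

theorem moveCopy_mulVec_fst (x : Token d N L) (z : Slot N L × Option (Fin d)) :
    (moveCopy d N L).mulVec x (scratch (Sum.inl (Sum.inl z))) = 0 := by
  simp [moveCopy_mulVec_apply, scratch_injective.eq_iff]

theorem moveCopy_mulVec_snd (x : Token d N L) (z : Slot N L × Option (Fin d)) :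
    (moveCopy d N L).mulVec x (scratch (Sum.inl (Sum.inr z)))
      = x (scratch (Sum.inl (Sum.inl z))) := by
  simp [moveCopy_mulVec_apply, scratch_injective.eq_iff]

/-! ### Filtering -/

/-- The index of the state carried by the token at a place. -/
def place : Slot N L → Fin (L + 1) := Sum.elim Prod.snd id

/-- The regression target of the token at a place. -/
def targetAt (α : ℝ) (l : Fin L) (q : Slot N L) (S : Slot N L → Fin d → ℝ) (a : Fin d) : ℝ :=
  match q with
  | Sum.inl (i, j) => if j = l.castSucc then leakyInv α (S (Sum.inl (i, l.succ)) a) else 0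
  | Sum.inr _ => 0

/-- The filtered token at a place of a prompt with given states. -/
def filteredAt (α : ℝ) (l : Fin L) (A : Matrix (Fin d) (Fin d) ℝ) (q : Slot N L)
    (S : Slot N L → Fin d → ℝ) : Token d N L :=
  enc (fun a => if place q = l.castSucc then S q a else 0)
    (fun a => if place q = l.succ then S q a else 0)
    ![if place q = l.castSucc then 1 else 0, if place q = l.succ then 1 else 0,
      if q = Sum.inr l.castSucc then 1 else 0]
    (fun i => S (Sum.inl (i, l.castSucc))) (fun i a => leakyInv α (S (Sum.inl (i, l.succ)) a))
    (targetAt α l q S) A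

/-- The case distinctions concern the fixed `q` and `l`, never the states. -/
theorem continuous_filteredAt (α : ℝ) (l : Fin L) (A : Matrix (Fin d) (Fin d) ℝ) (q : Slot N L) :
    Continuous (filteredAt α l A q) := by
  have hinv := continuous_leakyInv α
  refine continuous_enc ?_ ?_ ?_ ?_ ?_ ?_ ?_
  · split_ifs <;> fun_prop
  · split_ifs <;> fun_prop
  · fun_prop
  · fun_prop
  · fun_prop
  · refine continuous_pi fun a => ?_
    unfold targetAt
    rcases q with ⟨i, j⟩ | j
    · dsimp only
      split_ifs <;> fun_prop
    · fun_prop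
  · fun_prop

/-- The number of tokens of the prompt, recovered from the second copy of the prompt. -/
def count (x : Token d N L) : ℝ :=
  (max (x (scratch (Sum.inl (Sum.inr (Sum.inr 0, none)))))
    ((N * (L + 1) + (L + 1) : ℕ) : ℝ)⁻¹)⁻¹

/-- The inverse length of the longest prompt, as a floor, keeps the inverted quantity away from zero
on all inputs. -/
theorem continuous_count : Continuous (count : Token d N L → ℝ) := by
  refine Continuous.inv₀ (by fun_prop) fun x => (lt_max_of_lt_right ?_).ne'
  positivity

/-- The states of the prompt, recovered from the second copy of the prompt. -/
def states (x : Token d N L) (q : Slot N L) (a : Fin d) : ℝ :=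
  count x * x (scratch (Sum.inl (Sum.inr (q, some a))))

/-- The indicator of the prompts that end with state `l`, recovered from the second copy of the
prompt. -/
def layerInd (l : Fin L) (x : Token d N L) : ℝ :=
  count x * (x (scratch (Sum.inl (Sum.inr (Sum.inr l.castSucc, none))))
    - x (scratch (Sum.inl (Sum.inr (Sum.inr l.succ, none)))))

/-- The filtered token, computed from the two copies of the prompt. -/
def collect (α : ℝ) (A : Matrix (Fin d) (Fin d) ℝ) (x : Token d N L) : Token d N L :=
  ∑ l, ∑ q, (layerInd l x * x (scratch (Sum.inl (Sum.inl (q, none))))) •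
    filteredAt α l A q (states x)

/-- The layer and the place are selected by continuous weights, which are 0-1 only on genuine
prompts, so no discontinuous test on the input occurs. -/
theorem continuous_collect (α : ℝ) (A : Matrix (Fin d) (Fin d) ℝ) :
    Continuous (collect α A : Token d N L → Token d N L) := by
  have hc : Continuous (count : Token d N L → ℝ) := continuous_count
  refine continuous_finsetSum _ fun l _ => continuous_finsetSum _ fun q _ => ?_
  have hs : Continuous (states : Token d N L → Slot N L → Fin d → ℝ) :=
    continuous_pi fun q => continuous_pi fun a => hc.mul (by fun_prop)
  have hl : Continuous (layerInd l : Token d N L → ℝ) := hc.mul (by fun_prop)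
  exact (hl.mul (continuous_apply _)).smul ((continuous_filteredAt α l A q).comp hs)

/-- The place of a token in the longest prompt. -/
def slot {l : Fin L} : Tok N l → Slot N L
  | Sum.inl z => Sum.inl z
  | Sum.inr j => Sum.inr (Fin.castLE (Nat.succ_le_succ l.isLt.le) j)

theorem slot_injective {l : Fin L} : Function.Injective (slot : Tok N l → Slot N L) := by
  rintro (z | j) (z' | j') h
  · simpa [slot] using h
  · simp [slot] at h
  · simp [slot] at h
  · simpa [slot] using h

/-- The states at the places of the longest prompt, `0` where the prompt has no token. -/
def slotState {l : Fin L} {E : Type} [AddCommMonoid E] (s : Tok N l → E) (q : Slot N L) : E :=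
  ∑ c, if q = slot c then s c else 0

theorem slotState_slot {l : Fin L} {E : Type} [AddCommMonoid E] (s : Tok N l → E) (c : Tok N l) :
    slotState s (slot c) = s c := by
  simp [slotState, slot_injective.eq_iff]

theorem slotState_one_inr {l : Fin L} (j : Fin (L + 1)) :
    slotState (fun _ : Tok N l => (1 : ℝ)) (Sum.inr j) = if (j : ℕ) ≤ l then 1 else 0 := by
  split_ifs with h
  · exact slotState_slot (fun _ : Tok N l => (1 : ℝ)) (Sum.inr ⟨j, Nat.lt_succ_of_le h⟩)
  · refine Finset.sum_eq_zero fun c _ => if_neg ?_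
    rcases c with z | j'
    · simp [slot]
    · simp only [slot, Sum.inr.injEq, Fin.ext_iff, Fin.val_castLE]
      omega

theorem spread_start_none (q q' : Slot N L) (v : Fin d → ℝ) :
    spread (start q v) (scratch (Sum.inl (Sum.inl (q', none)))) = if q' = q then 1 else 0 := by
  simp [spread, start, oneHot]

theorem spread_start_some (q q' : Slot N L) (v : Fin d → ℝ) (a : Fin d) :
    spread (start q v) (scratch (Sum.inl (Sum.inl (q', some a)))) = if q' = q then v a else 0 := by
  simp [spread, start, oneHot, stateCore]

theorem spread_start_snd (q : Slot N L) (v : Fin d → ℝ) (z : Slot N L × Option (Fin d)) :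
    spread (start q v) (scratch (Sum.inl (Sum.inr z))) = 0 := by
  simp [spread, start, oneHot]

/-- Different tokens occupy different places, so averaging the spread tokens superposes them without
collision; only the factor 1/n has to be undone. -/
theorem collect_gather (α : ℝ) (A : Matrix (Fin d) (Fin d) ℝ) {l : Fin L}
    (X : Matrix (Row d (Fintype.card (Scratch d N L))) (Tok N l) ℝ) (s : Tok N l → Fin d → ℝ)
    (hX : ∀ c, X.col c = start (slot c) (s c)) (c : Tok N l) :
    collect α A (gather spread (moveCopy d N L) X c) = filteredAt α l A (slot c) (slotState s) := by
  set x := gather spread (moveCopy d N L) X c with hx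
  set n : ℝ := (Fintype.card (Tok N l) : ℝ) with hn
  have hcard : Fintype.card (Tok N l) = N * (L + 1) + ((l : ℕ) + 1) := by simp
  have hn0 : 0 < n := by rw [hn, hcard]; positivity
  have hfst : ∀ q, x (scratch (Sum.inl (Sum.inl (q, none)))) = if q = slot c then 1 else 0 := by
    intro q
    rw [hx, gather, Pi.add_apply, moveCopy_mulVec_fst, hX, spread_start_none, add_zero]
  have hsnd : ∀ q, x (scratch (Sum.inl (Sum.inr (q, none))))
      = n⁻¹ * slotState (fun _ : Tok N l => (1 : ℝ)) q := by
    intro q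
    rw [hx, gather, Pi.add_apply, moveCopy_mulVec_snd, hX, spread_start_snd, zero_add, mean]
    simp only [Matrix.of_apply, hX, spread_start_none]
    rfl
  have hsome : ∀ q a, x (scratch (Sum.inl (Sum.inr (q, some a)))) = n⁻¹ * slotState s q a := by
    intro q a
    rw [hx, gather, Pi.add_apply, moveCopy_mulVec_snd, hX, spread_start_snd, zero_add, mean]
    simp only [Matrix.of_apply, hX, spread_start_some, slotState, Finset.sum_apply, ite_apply]
    rfl
  -- Every prompt contains `x_test`, so the mean of its indicator is exactly 1/n, and the floor in
  -- `count` is inactive because no prompt is longer than the longest one.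
  have hcount : count x = n := by
    have hle : n ≤ ((N * (L + 1) + (L + 1) : ℕ) : ℝ) := by
      rw [hn, hcard]
      exact Nat.cast_le.2 (Nat.add_le_add_left (Nat.succ_le_succ l.isLt.le) _)
    rw [count, hsnd, slotState_one_inr, if_pos (by simp), mul_one,
      max_eq_left (inv_anti₀ hn0 hle), inv_inv]
  have hstates : states x = slotState s := by
    funext q a
    rw [states, hcount, hsome, mul_inv_cancel_left₀ hn0.ne']
  -- The place of ŝ^j is occupied exactly for j ≤ `l`, so consecutive differences single out `l`.
  -- The place of ŝ^L is always empty and serves the difference for the last layer.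
  have hind : ∀ l', layerInd l' x = if l' = l then 1 else 0 := by
    intro l'
    rw [layerInd, hcount, hsnd, hsnd, ← mul_sub, mul_inv_cancel_left₀ hn0.ne',
      slotState_one_inr, slotState_one_inr]
    simp only [Fin.val_castSucc, Fin.val_succ, Fin.ext_iff]
    rcases lt_trichotomy (l' : ℕ) l with h | h | h
    · rw [if_pos h.le, if_pos (by omega), if_neg h.ne, sub_self]
    · rw [if_pos h.le, if_neg (by omega), if_pos h, sub_zero]
    · rw [if_neg (by omega), if_neg (by omega), if_neg h.ne', sub_self]
  simp only [collect, hstates, hind, hfst]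
  rw [Finset.sum_eq_single l (fun l' _ h => by simp [h]) (by simp),
    Finset.sum_eq_single (slot c) (fun q _ h => by simp [h]) (by simp)]
  simp

theorem iterate_gradStep_filteredAt (α η : ℝ) (l : Fin L) (A : Matrix (Fin d) (Fin d) ℝ)
    (q : Slot N L) (S : Slot N L → Fin d → ℝ) (t : ℕ) :
    (gradStep η)^[t] (filteredAt α l A q S) = filteredAt α l (gradDescent
      (fun i => S (Sum.inl (i, l.castSucc))) (fun i a => leakyInv α (S (Sum.inl (i, l.succ)) a))
      η A t) q S :=
  iterate_gradStep_enc ..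

/-! ### The prompt -/

/-- The position of a place, counted from `0`. -/
def slotPos : Slot N L → ℕ
  | Sum.inl (i, j) => (i : ℕ) * (L + 1) + (j : ℕ)
  | Sum.inr j => N * (L + 1) + (j : ℕ)

theorem slotPos_injective : Function.Injective (slotPos : Slot N L → ℕ) := by
  have hlt : ∀ (i : Fin N) (j : Fin (L + 1)), (i : ℕ) * (L + 1) + (j : ℕ) < N * (L + 1) :=
    fun i j => by nlinarith [i.isLt, j.isLt]
  rintro (⟨i, j⟩ | j) (⟨i', j'⟩ | j') h
  · have : finProdFinEquiv (i, j) = finProdFinEquiv (i', j') := by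
      ext; simpa [slotPos, finProdFinEquiv, mul_comm, add_comm] using h
    rw [finProdFinEquiv.injective this]
  · have := hlt i j; simp only [slotPos] at h; omega
  · have := hlt i' j'; simp only [slotPos] at h; omega
  · simpa [slotPos, Fin.ext_iff] using h

/-- Shorter prompts are prefixes of the longest one, which is why one positional embedding works for
all `l`. -/
theorem slotPos_slot {l : Fin L} (c : Tok N l) : slotPos (slot c) = pos c := by
  rcases c with ⟨i, j⟩ | j <;> rfl

/-- The one-hot positional embedding, in the scratch coordinates. -/
def position (d N L : ℕ) (n : ℕ) (b : Fin (Fintype.card (Scratch d N L))) : ℝ :=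
  match (Fintype.equivFin _).symm b with
  | Sum.inl (Sum.inl (q, none)) => if slotPos q = n then 1 else 0
  | _ => 0

theorem prompt_col (α : ℝ) (W : Fin L → Matrix (Fin d) (Fin d) ℝ) (xs : Fin N → Fin d → ℝ)
    (xtest : Fin d → ℝ) (l : Fin L) (c : Tok N l) :
    (prompt (position d N L) α W xs xtest l).col c = start (slot c) (tokState α W xs xtest c) := by
  funext r
  rcases r with ((a | a | a) | i) | b
  · rfl
  · rfl
  · rfl
  · rfl
  · change position d N L (pos c) b = oneHot (slot c) ((Fintype.equivFin _).symm b)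
    rw [position, ← slotPos_slot]
    rcases (Fintype.equivFin (Scratch d N L)).symm b with (⟨q, _ | a⟩ | s) | s
    · simp only [oneHot, slotPos_injective.eq_iff]
    · rfl
    · rfl
    · rfl

/-- One formula, `A` times the current block minus the stored target, gives every residual entry:
the target is zero at the last token, and both terms vanish at discarded tokens. -/
theorem filteredAt_inl (α : ℝ) (W : Fin L → Matrix (Fin d) (Fin d) ℝ) (xs : Fin N → Fin d → ℝ)
    (xtest : Fin d → ℝ) (l : Fin L) (A : Matrix (Fin d) (Fin d) ℝ) (r : CoreRow d) (c : Tok N l) :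
    (filteredAt α l A (slot c) (slotState (tokState α W xs xtest (l := l))) : Token d N L)
      (Sum.inl r) = filtered α W xs xtest l A r c := by
  set S : Slot N L → Fin d → ℝ := slotState (tokState α W xs xtest (l := l)) with hSdef
  have hS : ∀ i j, S (Sum.inl (i, j)) = chain α W (xs i) j :=
    fun i j => slotState_slot (tokState α W xs xtest) (Sum.inl (i, j) : Tok N l)
  rcases c with ⟨i, j⟩ | j
  · have hp : place (Sum.inl (i, j) : Slot N L) = j := rfl
    change (filteredAt α l A (Sum.inl (i, j)) S : Token d N L) _ = _
    rcases r with (a | a | a) | m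
    · simp only [filteredAt, enc, mk_inl, filteredCore, filtered, Matrix.of_apply, hp, hS]
      split_ifs with h <;> simp [h]
    · simp only [filteredAt, enc, mk_inl, filteredCore, filtered, Matrix.of_apply, hp, hS]
      split_ifs with h <;> simp [h]
    · simp only [filteredAt, enc, mk_inl, filteredCore, filtered, Matrix.of_apply, hp, hS, targetAt]
      split_ifs with h
      · subst h; rfl
      · simp [Matrix.mulVec, dotProduct]
    · fin_cases m <;> simp [filteredAt, enc, filteredCore, filtered, hp]
  · have hs := slotState_slot (tokState α W xs xtest) (Sum.inr j : Tok N l)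
    have h1 : Fin.castLE (Nat.succ_le_succ l.isLt.le) j = l.castSucc ↔ j = Fin.last (l : ℕ) := by
      simp [Fin.ext_iff]
    have h2 : Fin.castLE (Nat.succ_le_succ l.isLt.le) j ≠ l.succ := by
      simp only [ne_eq, Fin.ext_iff, Fin.val_castLE, Fin.val_succ]; omega
    rw [tokState] at hs
    change (filteredAt α l A (Sum.inr (Fin.castLE (Nat.succ_le_succ l.isLt.le) j)) S : Token d N L) _
      = _
    change S (Sum.inr (Fin.castLE (Nat.succ_le_succ l.isLt.le) j)) = _ at hs
    generalize Fin.castLE (Nat.succ_le_succ l.isLt.le) j = j' at *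
    have hp : place (Sum.inr j' : Slot N L) = j' := rfl
    rcases r with (a | a | a) | m
    · simp only [filteredAt, enc, mk_inl, filteredCore, filtered, Matrix.of_apply, hp, hs, ← h1]
      split_ifs with h <;> simp [h]
    · simp [filteredAt, enc, filteredCore, filtered, hp, h2]
    · simp only [filteredAt, enc, mk_inl, filteredCore, filtered, Matrix.of_apply, hp, hs, ← h1,
        targetAt]
      split_ifs with h
      · simp [h]
      · simp [Matrix.mulVec, dotProduct]
    · fin_cases m <;> simp [filteredAt, enc, filteredCore, filtered, hp, ← h1, h2]

end Token

/-! ### Assembling the AlgoFormer -/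

section Assembly

variable {ι : Type} [Fintype ι] {τ : Type} [Fintype τ] {h : ℕ}

theorem Transformer.eval_one (f : Transformer ι 1 h) (X : Matrix ι τ ℝ) :
    Transformer.eval f X = (f 0).eval X := rfl

theorem Transformer.col_iterate_eval {f : Transformer ι 1 h} {g : (ι → ℝ) → ι → ℝ}
    (hf : ∀ (X : Matrix ι τ ℝ) c, ((f 0).eval X).col c = g (X.col c)) (t : ℕ) (X : Matrix ι τ ℝ)
    (c : τ) : ((fun Y => Transformer.eval f Y)^[t] X).col c = g^[t] (X.col c) := by
  induction t generalizing X with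
  | zero => rfl
  | succ t ih =>
    rw [Function.iterate_succ_apply, Function.iterate_succ_apply, ih, Transformer.eval_one, hf]

/-- Two layers, padded to seven by layers that do nothing. -/
theorem exists_transformer_seven (h : ℕ) [NeZero h] (l₀ l₁ : Layer ι h) :
    ∃ f : Transformer ι 7 h, ∀ (τ : Type) [Fintype τ] (X : Matrix ι τ ℝ),
      Transformer.eval f X = l₁.eval (l₀.eval X) := by
  obtain ⟨e, he⟩ := exists_tokenwise_layer (h := h) (isNet_id (ι := ι))
  have he' : ∀ (τ : Type) [Fintype τ] (X : Matrix ι τ ℝ), e.eval X = X := fun τ _ X => by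
    ext r c
    exact congrFun (he τ X c) r
  refine ⟨![l₀, l₁, e, e, e, e, e], fun τ _ X => ?_⟩
  change e.eval (e.eval (e.eval (e.eval (e.eval (l₁.eval (l₀.eval X)))))) = _
  simp only [he']

end Assembly

theorem abs_tokState_le {d L N : ℕ} {α M : ℝ} {W : Fin L → Matrix (Fin d) (Fin d) ℝ}
    {xs : Fin N → Fin d → ℝ} {xtest : Fin d → ℝ} (hx : ∀ i j a, |chain α W (xs i) j a| ≤ M)
    (ht : ∀ j a, |chain α W xtest j a| ≤ M) {l : Fin L} (c : Tok N l) (a : Fin d) :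
    |tokState α W xs xtest c a| ≤ M := by
  rcases c with ⟨i, j⟩ | j
  · exact hx i j a
  · exact ht _ a

open Token in
/-- An AlgoFormer that follows gradient descent on all prompts with states bounded by `M`. -/
theorem exists_algoFormer (d L N : ℕ) (α : ℝ) {M : ℝ} (hM : 0 ≤ M) (A₀ : Matrix (Fin d) (Fin d) ℝ)
    (η : ℝ) (T : ℕ) {ε : ℝ} (hε : 0 < ε) :
    ∃ F : AlgoFormer (Row d (Fintype.card (Scratch d N L))) 7 2 1 2 1 1,
      ∀ (W : Fin L → Matrix (Fin d) (Fin d) ℝ) (xs : Fin N → Fin d → ℝ) (xtest : Fin d → ℝ),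
        (∀ i j a, |chain α W (xs i) j a| ≤ M) → (∀ j a, |chain α W xtest j a| ≤ M) →
        ∀ (l : Fin L), ∀ t ≤ T,
          (∀ r c, |F.hidden t (prompt (position d N L) α W xs xtest l) (Sum.inl r) c
            - filtered α W xs xtest l
                (gradDescent (regIn α W xs l) (regOut α W xs l) η A₀ t) r c| ≤ ε) ∧
          (∀ a, |F.output t (prompt (position d N L) α W xs xtest l) (Sum.inl (CoreRow.next a))
              (lastTok N l)
            - leaky α ((gradDescent (regIn α W xs l) (regOut α W xs l) η A₀ t).mulVec
                (chain α W xtest l.castSucc) a)| ≤ ε) := by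
  -- Radii that hold for all data, layers and places: `R₁` for the exact filtered tokens, then `R₂`
  -- for their first `T` gradient steps.
  obtain ⟨R₁, hR₁⟩ : ∃ R, ∀ (l : Fin L) (q : Slot N L) (S : Slot N L → Fin d → ℝ), ‖S‖ ≤ M →
      ‖(filteredAt α l A₀ q S : Token d N L)‖ ≤ R := by
    have h : ∀ p : Fin L × Slot N L, ∃ R, ∀ S : Slot N L → Fin d → ℝ, ‖S‖ ≤ M →
        ‖(filteredAt α p.1 A₀ p.2 S : Token d N L)‖ ≤ R := fun p => by
      obtain ⟨R, hR⟩ :=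
        (isCompact_closedBall (0 : Slot N L → Fin d → ℝ) M).exists_bound_of_continuousOn
          (continuous_filteredAt α p.1 A₀ p.2).continuousOn
      exact ⟨R, fun S hS => hR S (mem_closedBall_zero_iff.2 hS)⟩
    choose R hR using h
    refine ⟨∑ p, |R p|, fun l q S hS => (hR (l, q) S hS).trans ((le_abs_self _).trans ?_)⟩
    exact Finset.single_le_sum (f := fun p => |R p|) (fun _ _ => abs_nonneg _)
      (Finset.mem_univ (l, q))
  obtain ⟨R₂, hR₂⟩ : ∃ R, ∀ t ≤ T, ∀ x : Token d N L, ‖x‖ ≤ R₁ → ‖(gradStep η)^[t] x‖ ≤ R := by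
    choose R hR using fun t => exists_bound_of_continuous _
      ((continuous_gradStep η : Continuous (gradStep η : Token d N L → _)).iterate t) R₁
    refine ⟨∑ t ∈ Finset.range (T + 1), |R t|, fun t ht x hx =>
      (hR t x hx).trans ((le_abs_self _).trans ?_)⟩
    exact Finset.single_le_sum (f := fun t => |R t|) (fun _ _ => abs_nonneg _)
      (Finset.mem_range.2 (Nat.lt_succ_of_le ht))
  -- The networks are chosen from the last to the first, each meeting the tolerance that the next
  -- one requires.
  obtain ⟨f₃, hf₃, δ₃, hδ₃, h₃⟩ := exists_isNet_robust_near (predict α : Token d N L → Token d N L)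
    (continuous_predict α) R₂ hε
  obtain ⟨f₂, hf₂, δ₂, hδ₂, h₂⟩ := exists_isNet_iterate_near
    (gradStep η : Token d N L → Token d N L) (continuous_gradStep η) T R₁ (lt_min hδ₃ hε)
  obtain ⟨l₀, l₁, h₁⟩ := exists_layers_near
    (continuous_spread : Continuous (spread : Token d N L → _))
    (continuous_collect α A₀) (moveCopy d N L) 2 (M + 1) hδ₂
  obtain ⟨pre, hpre⟩ := exists_transformer_seven 2 l₀ l₁
  obtain ⟨l₂, hl₂⟩ := exists_tokenwise_layer (h := 2) hf₂
  obtain ⟨l₃, hl₃⟩ := exists_tokenwise_layer (h := 1) hf₃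
  obtain ⟨F, hFpre, hFloop, hFpost⟩ :
      ∃ F : AlgoFormer (Row d (Fintype.card (Scratch d N L))) 7 2 1 2 1 1,
        F.pre = pre ∧ F.loop 0 = l₂ ∧ F.post 0 = l₃ :=
    ⟨⟨pre, fun _ => l₂, fun _ => l₃⟩, rfl, rfl, rfl⟩
  refine ⟨F, fun W xs xtest hx ht l t htT => ?_⟩
  set X := prompt (position d N L) α W xs xtest l with hX
  set S : Slot N L → Fin d → ℝ := slotState (tokState α W xs xtest (l := l)) with hS
  set At := gradDescent (regIn α W xs l) (regOut α W xs l) η A₀ t with hAt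
  have hSM : ‖S‖ ≤ M := by
    refine (pi_norm_le_iff_of_nonneg hM).2 fun q => (pi_norm_le_iff_of_nonneg hM).2 fun a => ?_
    by_cases hq : ∃ c : Tok N l, slot c = q
    · obtain ⟨c, rfl⟩ := hq
      rw [hS, slotState_slot]
      exact abs_tokState_le hx ht c a
    · rw [hS, slotState, Finset.sum_eq_zero fun c _ => if_neg fun h => hq ⟨c, h.symm⟩]
      simpa using hM
  have hin : ∀ c, ‖X.col c‖ ≤ M + 1 := fun c => by
    rw [hX, prompt_col]
    exact norm_start_le _ hM (abs_tokState_le hx ht c)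
  have hpre' : ∀ c, ‖(F.pre.eval X).col c - filteredAt α l A₀ (slot c) S‖ ≤ δ₂ := fun c => by
    have := h₁ (Tok N l) X hin c
    rwa [collect_gather α A₀ X (tokState α W xs xtest) (prompt_col α W xs xtest l) c, ← hpre, ← hFpre]
      at this
  have hiter : ∀ c : Tok N l, (gradStep η)^[t] (filteredAt α l A₀ (slot c) S)
      = (filteredAt α l At (slot c) S : Token d N L) := fun c => by
    have h1 : ∀ i j, S (Sum.inl (i, j)) = chain α W (xs i) j :=
      fun i j => slotState_slot (tokState α W xs xtest) (Sum.inl (i, j) : Tok N l)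
    rw [iterate_gradStep_filteredAt]
    simp only [h1]
    rfl
  have hhid : ∀ c, ‖(F.hidden t X).col c - filteredAt α l At (slot c) S‖ ≤ min δ₃ ε := fun c => by
    have hloop := Transformer.col_iterate_eval (f := F.loop) (τ := Tok N l) (g := f₂)
      (fun Y c => by rw [hFloop, hl₂]) t (F.pre.eval X) c
    rw [AlgoFormer.hidden, hloop, ← hiter]
    exact h₂ t htT _ _ (hR₁ _ _ _ hSM) (hpre' c)
  refine ⟨fun r c => ?_, fun a => ?_⟩
  · rw [← filteredAt_inl]
    exact (norm_le_pi_norm _ (Sum.inl r)).trans ((hhid c).trans (min_le_right _ _))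
  · have hout := h₃ _ (filteredAt α l At (slot (lastTok N l)) S)
      (hiter (lastTok N l) ▸ hR₂ t htT _ (hR₁ _ _ _ hSM)) ((hhid _).trans (min_le_left _ _))
    rw [← hl₃, ← hFpost, ← Transformer.eval_one] at hout
    have hres : predict α (filteredAt α l At (slot (lastTok N l)) S : Token d N L)
        (Sum.inl (CoreRow.next a)) = leaky α (At.mulVec (chain α W xtest l.castSucc) a) := by
      change leaky α ((filteredAt α l At (slot (lastTok N l)) S : Token d N L)
        (Sum.inl (Sum.inl (Sum.inr (Sum.inr a))))) = _
      rw [filteredAt_inl]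
      simp [filtered]
    rw [← hres]
    exact (norm_le_pi_norm _ (Sum.inl (CoreRow.next a))).trans hout

/-- The regression is realizable: `W l` fits all samples exactly, as the convergence estimate
requires. -/
theorem regOut_eq {d L N : ℕ} {α : ℝ} (hα : 0 < α) (W : Fin L → Matrix (Fin d) (Fin d) ℝ)
    (xs : Fin N → Fin d → ℝ) (l : Fin L) (i : Fin N) :
    regOut α W xs l i = (W l).mulVec (regIn α W xs l i) := by
  funext a
  simp only [regOut, chain_succ, leakyInv_leaky hα]
  rfl

end CoTMLP

end

theorem theorem3 (d L N : ℕ) (hN : 0 < N) (α : ℝ) (hα : 0 < α) :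
    ∃ (k : ℕ) (p : ℕ → Fin k → ℝ),
      ∀ (B : ℝ) (A₀ : Matrix (Fin d) (Fin d) ℝ), ∃ η₀ > 0, ∃ C : ℝ,
        ∀ η > 0, ∀ (T : ℕ), ∀ ε > 0, ∃ F : AlgoFormer (Row d k) 7 2 1 2 1 1,
          ∀ (W : Fin L → Matrix (Fin d) (Fin d) ℝ) (xs : Fin N → Fin d → ℝ) (xtest : Fin d → ℝ),
            (∀ j a b, |W j a b| ≤ B) → (∀ i a, |xs i a| ≤ B) → (∀ a, |xtest a| ≤ B) →
            ∀ (l : Fin L), ∀ t ≤ T,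
              -- pre-transformer and `t` loops: filtering, then `t` steps of gradient descent
              (∀ r c, |F.hidden t (prompt p α W xs xtest l) (Sum.inl r) c
                - filtered α W xs xtest l
                    (gradDescent (regIn α W xs l) (regOut α W xs l) η A₀ t) r c| ≤ ε) ∧
              -- the output is the next state predicted by the fitted weight matrix
              (∀ a, |F.output t (prompt p α W xs xtest l) (Sum.inl (CoreRow.next a)) (lastTok N l)
                - leaky α ((gradDescent (regIn α W xs l) (regOut α W xs l) η A₀ t).mulVec
                    (chain α W xtest l.castSucc) a)| ≤ ε) ∧
              -- and it approaches the true next state, if the samples determine it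
              (η ≤ η₀ →
                chain α W xtest l.castSucc ∈ Submodule.span ℝ (Set.range (regIn α W xs l)) →
                ∀ κ > 0,
                  (∀ v ∈ Submodule.span ℝ (Set.range (regIn α W xs l)),
                    κ * (v ⬝ᵥ v) ≤ 1 / (N : ℝ) * ∑ i, (regIn α W xs l i ⬝ᵥ v) ^ 2) →
                  ∀ a, |F.output t (prompt p α W xs xtest l) (Sum.inl (CoreRow.next a))
                      (lastTok N l) - chain α W xtest l.succ a|
                    ≤ ε + C * Real.exp (-(η * κ * t))) := by
  refine ⟨_, Token.position d N L, fun B A₀ => ?_⟩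
  obtain ⟨M, hM, hchain⟩ := exists_chain_bound d L hα B
  set K : ℝ := (∑ a, ∑ b, |A₀ a b|) + |B| with hK
  have hη₀ : 0 < d * M ^ 2 + 1 := by positivity
  -- The squared norms of the states are at most `d * M ^ 2`; the extra 1 avoids a zero denominator.
  -- In `C`, `1 + α` is a Lipschitz constant of leaky ReLU and `K` bounds the entries of `A₀ - W l`.
  refine ⟨(d * M ^ 2 + 1)⁻¹, inv_pos.2 hη₀, (1 + α) * (d * (K * (Real.sqrt d * M))),
    fun η hη T ε hε => ?_⟩
  obtain ⟨F, hF⟩ := exists_algoFormer d L N α hM A₀ η T hε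
  refine ⟨F, fun W xs xtest hW hxs hxt l t ht => ?_⟩
  obtain ⟨h1, h2⟩ := hF W xs xtest (fun i => hchain W (xs i) hW (hxs i)) (hchain W xtest hW hxt)
    l t ht
  refine ⟨h1, h2, fun hη' hspan κ _ hκ a => ?_⟩
  have hstep : η * (d * M ^ 2) ≤ 1 := by
    have := mul_le_mul_of_nonneg_right hη' hη₀.le
    rw [inv_mul_cancel₀ hη₀.ne'] at this
    linarith
  have hAW : ∀ a b, |(A₀ - W l) a b| ≤ K := fun a b => by
    have h3 : |A₀ a b| ≤ ∑ a, ∑ b, |A₀ a b| :=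
      (Finset.single_le_sum (f := fun b => |A₀ a b|) (fun _ _ => abs_nonneg _)
        (Finset.mem_univ b)).trans (Finset.single_le_sum (f := fun a => ∑ b, |A₀ a b|)
          (fun _ _ => Finset.sum_nonneg fun _ _ => abs_nonneg _) (Finset.mem_univ a))
    rw [Matrix.sub_apply]
    exact (abs_sub _ _).trans (add_le_add h3 ((hW l a b).trans (le_abs_self B)))
  have hdec := abs_gradDescent_sub_le hN hη hM (regOut_eq hα W xs l)
    (fun i a => hchain W (xs i) hW (hxs i) _ a) hstep hAW hκ hspan
    (hchain W xtest hW hxt _) t a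
  -- The true next state is leaky ReLU of `W l` applied to ŝ^ℓ; it is compared with the output
  -- through the prediction of the fitted matrix.
  rw [chain_succ]
  refine (abs_sub_le _ _ _).trans (add_le_add (h2 a) ((abs_leaky_sub_le hα _ _).trans
    ((mul_le_mul_of_nonneg_left hdec (by positivity)).trans_eq (by ring))))
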